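/- Let $(M,g)$ be an oriented four-dimensional spacetime: a smooth (Hausdorff) oriented manifold with a smooth metric $g$ of signature $(-,+,+,+)$. Write $(x,y)=g(x,y)$, $x^2=g(x,x)$, let $\nabla$ be the Levi-Civita connection and $*$ the Hodge dual, and identify vectors with one-forms by means of $g$. Let $u$ be a smooth time-like unit vector field, $u^2=-1$, with expansion $\theta=\nabla\cdot u$ and acceleration $a=\nabla_u u$ ($=i(u)\,\mathrm{d}u$), and assume that $u$ is expanding and non-geodesic: $\theta\neq 0$ and $a\neq 0$ at every point of $M$. Put $$v=*(a\wedge \mathrm{d}a),\qquad \nu = 2+\frac{1}{\theta\,a^2}\, i(a)\,\mathrm{d}\theta .$$ Fix a real number $\gamma>1$ (the adiabatic index). A smooth real function $f$ on an open set $U\subseteq M$ is called a solution on $U$ if on $U$ $$u(f)=\theta\,[(\gamma-1)f-1],\qquad \mathrm{d}(\theta u-fa)=0 .$$ Suppose that there is a solution $f_0$ on $M$. Then: 1. If $f$ is a solution on an open set $U$, then $v=0$ and $\nu=0$ at every point of $U$ that lies in the closure of $\{y\in U: f(y)\neq f_0(y)\}$. 2. For every $x_0\in M$, the following are equivalent: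 (i) on some open neighbourhood $U$ of $x_0$ there is a second solution $f$, with $f(y)\neq f_0(y)$ for all $y\in U$; (ii) $v=0$ and $\nu=0$ on a neighbourhood of $x_0$. 3. Let $W\subseteq M$ be open with $v=0$ and $\nu=0$ on $W$. Then every point of $W$ has an open neighbourhood in $W$ on which there are smooth functions $\alpha,\beta$, with $\beta$ nowhere zero, such that $\beta a=\mathrm{d}\alpha$. If $\alpha,\beta$ are any such functions on $W$, then the solutions are, locally, the functions $$f=f_0+\beta\,\varphi(\alpha)$$ with $\varphi$ an arbitrary smooth real function. That is: for every function $\varphi$ that is smooth on $\alpha(W)$, $f_0+\beta\varphi(\alpha)$ is a solution on $W$; and every $x\in W$ has an open neighbourhood $V\subseteq W$ such that every solution $f$ on $V$ is equal on $V$ to $f_0+\beta\varphi(\alpha)$ for some function $\varphi$ that is smooth on $\alpha(V)$. -/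

import Mathlib

open scoped Manifold ContDiff Topology
open Bundle

noncomputable section

namespace Spacetime

/-- The model space `ℝ⁴` of a four-dimensional spacetime. -/
abbrev R4 : Type := EuclideanSpace ℝ (Fin 4)

/-- The tangent space of the smooth 4-manifold `M` at `x`. -/
abbrev Tan {M : Type*} [TopologicalSpace M] [ChartedSpace R4 M] (x : M) : Type :=
  TangentSpace (𝓡 4) x

/-- The diagonal entries of the signature `(-,+,+,+)`. -/
def sgn (i : Fin 4) : ℝ := if i = 0 then -1 else 1

variable {M : Type*} [TopologicalSpace M] [ChartedSpace R4 M] [IsManifold (𝓡 4) ∞ M]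

variable (M) in
/-- A smooth Lorentzian metric of signature `(-,+,+,+)` on `M`. -/
structure LorentzMetric where
  /-- the metric product of two tangent vectors -/
  inner : ∀ x : M, Tan x →L[ℝ] Tan x →L[ℝ] ℝ
  symm : ∀ (x : M) (X Y : Tan x), inner x X Y = inner x Y X
  signature : ∀ x : M, ∃ e : Module.Basis (Fin 4) ℝ (Tan x),
    ∀ i j, inner x (e i) (e j) = if i = j then sgn i else 0
  contMDiff : ContMDiff (𝓡 4) ((𝓡 4).prod 𝓘(ℝ, R4 →L[ℝ] R4 →L[ℝ] ℝ)) ∞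
    (fun x : M ↦ TotalSpace.mk' (R4 →L[ℝ] R4 →L[ℝ] ℝ)
      (E := fun x : M ↦ (Tan x →L[ℝ] Tan x →L[ℝ] ℝ)) x (inner x))

variable (M) in
/-- An orientation of the manifold `M`: an orientation of every tangent space which is locally
constant in the local trivializations of the tangent bundle. -/
structure ManifoldOrientation where
  /-- the orientation of the tangent space at `x` -/
  at_ : ∀ x : M, Orientation ℝ (Tan x) (Fin 4)
  locallyConstant : ∀ x₀ : M, ∃ o₀ : Orientation ℝ R4 (Fin 4), ∀ᶠ y in 𝓝 x₀,
    ∃ hy : y ∈ (trivializationAt R4 (TangentSpace (𝓡 4) : M → Type _) x₀).baseSet,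
      at_ y = Orientation.map (Fin 4)
        ((trivializationAt R4 (TangentSpace (𝓡 4) : M → Type _) x₀).linearEquivAt ℝ y hy).symm o₀

/-- The differential of a function, as a one-form. -/
def differential (f : M → ℝ) (x : M) : Tan x →L[ℝ] ℝ := mvfderiv (𝓡 4) f x

/-- The exterior derivative of a one-form `η`, by the formula
`dη(X,Y) = X(η(Y)) - Y(η(X)) - η([X,Y])`, with any local extensions of the vectors `X`, `Y`. -/
def extD (η : ∀ x : M, Tan x →L[ℝ] ℝ) (x : M) (X Y : Tan x) : ℝ :=
  let X' : ∀ y : M, Tan y := FiberBundle.extend R4 X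
  let Y' : ∀ y : M, Tan y := FiberBundle.extend R4 Y
  differential (fun y ↦ η y (Y' y)) x X - differential (fun y ↦ η y (X' y)) x Y
    - η x (VectorField.mlieBracket (𝓡 4) X' Y' x)

/-- The exterior product `α ∧ B` of a one-form and a two-form at a point. -/
def wedge12 {x : M} (α : Tan x →L[ℝ] ℝ) (B : Tan x → Tan x → ℝ) (X Y Z : Tan x) : ℝ :=
  α X * B Y Z + α Y * B Z X + α Z * B X Y

namespace LorentzMetric

variable (g : LorentzMetric M)

/-- An orthonormal basis of the tangent space at `x` (the notions below do not depend on the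
choice). -/
def frame (x : M) : Module.Basis (Fin 4) ℝ (Tan x) := (g.signature x).choose

theorem inner_frame (x : M) (i j : Fin 4) :
    g.inner x (g.frame x i) (g.frame x j) = if i = j then sgn i else 0 :=
  (g.signature x).choose_spec i j

/-- The vector metrically equivalent to a covector. -/
def sharp {x : M} (α : Tan x → ℝ) : Tan x := ∑ i, (sgn i * α (g.frame x i)) • g.frame x i

/-- The covariant derivative `∇_X V` at `x` for the Levi-Civita connection of `g`, by the Koszul
formula for `2 g(∇_X V, Z)`, with any local extensions of the vectors `X`, `Z`. -/
def covDeriv (V : ∀ x : M, Tan x) (x : M) (X : Tan x) : Tan x :=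
  g.sharp fun Z ↦
    let X' : ∀ y : M, Tan y := FiberBundle.extend R4 X
    let Z' : ∀ y : M, Tan y := FiberBundle.extend R4 Z
    (1 / 2) * (differential (fun y ↦ g.inner y (V y) (Z' y)) x X
      + differential (fun y ↦ g.inner y (X' y) (Z' y)) x (V x)
      - differential (fun y ↦ g.inner y (X' y) (V y)) x Z
      + g.inner x (VectorField.mlieBracket (𝓡 4) X' V x) Z
      - g.inner x (VectorField.mlieBracket (𝓡 4) V Z' x) X
      - g.inner x (VectorField.mlieBracket (𝓡 4) X' Z' x) (V x))

/-- The divergence `∇ · V`, the trace of `X ↦ ∇_X V`. -/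
def div (V : ∀ x : M, Tan x) (x : M) : ℝ :=
  ∑ i, sgn i * g.inner x (g.covDeriv V x (g.frame x i)) (g.frame x i)

/-- The metric volume form, equal to `1` on positively oriented orthonormal bases. -/
def vol (o : ManifoldOrientation M) (x : M) : (Tan x) [⋀^Fin 4]→ₗ[ℝ] ℝ :=
  open Classical in
  if (g.frame x).orientation = o.at_ x then (g.frame x).det else -(g.frame x).det

/-- The Hodge dual of a three-form `T`, the vector with components
`(1/3!) T^{αβγ} η_{αβγδ}`, the last index being raised. -/
def hodge3 (o : ManifoldOrientation M) {x : M} (T : Tan x → Tan x → Tan x → ℝ) : Tan x :=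
  g.sharp fun W ↦ (1 / 6) * ∑ i, ∑ j, ∑ k, sgn i * sgn j * sgn k *
    T (g.frame x i) (g.frame x j) (g.frame x k) *
    g.vol o x ![g.frame x i, g.frame x j, g.frame x k, W]

variable (u : ∀ x : M, Tan x)

/-- The expansion `θ = ∇ · u`. -/
def expansion (x : M) : ℝ := g.div u x

/-- The acceleration vector `a = ∇_u u`. -/
def accel (x : M) : Tan x := g.covDeriv u x (u x)

/-- The one-form metrically equivalent to a vector field. -/
def flat (V : ∀ x : M, Tan x) (x : M) : Tan x →L[ℝ] ℝ := g.inner x (V x)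

/-- The vorticity of the acceleration, `v = *(a ∧ da)`. -/
def accelVorticity (o : ManifoldOrientation M) (x : M) : Tan x :=
  g.hodge3 o (wedge12 (g.flat (g.accel u) x) (extD (g.flat (g.accel u)) x))

/-- The scalar `ν = 2 + i(a)dθ / (θ a²)`. -/
def nu (x : M) : ℝ :=
  2 + differential (g.expansion u) x (g.accel u x) /
    (g.expansion u x * g.inner x (g.accel u x) (g.accel u x))

/-- `u` is a smooth unit time-like vector field. -/
def IsUnitTimelike : Prop :=
  ContMDiff (𝓡 4) (𝓡 4).tangent ∞ (fun x ↦ (⟨x, u x⟩ : TangentBundle (𝓡 4) M)) ∧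
    ∀ x, g.inner x (u x) (u x) = -1

/-- `f` is a smooth solution on the open set `U` of the differential system
`u(f) = θ ((γ - 1) f - 1)`, `d(θ u - f a) = 0`. -/
def IsSolutionOn (γ : ℝ) (f : M → ℝ) (U : Set M) : Prop :=
  ContMDiffOn (𝓡 4) 𝓘(ℝ, ℝ) ∞ f U ∧
    ∀ x ∈ U, differential f x (u x) = g.expansion u x * ((γ - 1) * f x - 1) ∧
      ∀ X Y : Tan x,
        extD (fun y ↦ g.expansion u y • g.flat u y - f y • g.flat (g.accel u) y) x X Y = 0

/-- `α` and `β` are smooth on the open set `U`, `β` has no zeros, and `β a = dα` on `U`. -/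
def IsPotentialOn (α β : M → ℝ) (U : Set M) : Prop :=
  ContMDiffOn (𝓡 4) 𝓘(ℝ, ℝ) ∞ α U ∧ ContMDiffOn (𝓡 4) 𝓘(ℝ, ℝ) ∞ β U ∧
    ∀ x ∈ U, β x ≠ 0 ∧ β x • g.flat (g.accel u) x = differential α x

end LorentzMetric

end Spacetime

end

/-! The difference h of two solutions solves a homogeneous system: u(h) = (γ-1)θh and dh ∧ a + h da
= 0. Wedging the second equation with a gives h a ∧ da = 0; contracting it with u gives h b = 0,
where b = i(u)da + (γ-1)θa. Contracting the momentum equation of any single solution f with u gives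
dθ + u(θ)u + 2θa = f b (`IsSolutionOn.contract`). Where h ≠ 0 the right side vanishes, and
evaluating the left side on a, which is orthogonal to u, gives ν = 0. Both constraints extend to the
closure by continuity (`IsSolutionOn.constraints_of_mem_closure`).

Conversely, let v = 0 and ν = 0 on an open set. Evaluating the contracted equation of f₀ on a, and
using a ∧ da = 0 to see that i(u)da is proportional to a, gives f₀ b = 0. At a zero of f₀ the
evolution equation reads u(f₀) = -θ ≠ 0, so differentiating f₀ b = 0 along u gives b = 0 there too.
Hence i(u)da = -(γ-1)θa everywhere (`IsSolutionOn.extD_accel_apply`). Frobenius gives βa = dα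
locally, so dβ ∧ a + β da = 0, and evaluation on (u, a) yields u(β) = (γ-1)θβ. As u(α) = 0, every
βφ(α) solves the homogeneous system; φ = 1 provides a second solution. In the other direction k =
h/β satisfies dk ∧ dα = 0, so k is locally a smooth function of α
(`exists_eq_comp_of_fderiv_eq_smul`).

The Frobenius theorem (`exists_integrating_factor`) is proved in a Banach space. After normalizing
a(e) = 1, horizontal curves are found as solutions of an integral equation, smooth in a parameter by
the inverse function theorem in a space of continuous curves; this rests on the smoothness of
superposition operators (`ContinuousMap.contDiff_comp_left`). The endpoint map of the curves is a
local diffeomorphism which straightens ker a. Geometry on the manifold enters through components in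
charts, where the exterior derivative, the Koszul formula and the divergence become explicit smooth
expressions. -/

noncomputable section

/-! ### Superposition operators on spaces of continuous curves -/

section Nemytskii

variable {K : Type*} [TopologicalSpace K] [CompactSpace K]

/-- Pointwise application of a bilinear map to continuous curves. -/
def ContinuousMap.bilinear (K : Type*) [TopologicalSpace K] [CompactSpace K]
    {E F G : Type*} [NormedAddCommGroup E] [NormedSpace ℝ E] [NormedAddCommGroup F]
    [NormedSpace ℝ F] [NormedAddCommGroup G] [NormedSpace ℝ G] (B : G →L[ℝ] E →L[ℝ] F) :
    C(K, G) →L[ℝ] C(K, E) →L[ℝ] C(K, F) :=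
  LinearMap.mkContinuous₂
    (LinearMap.mk₂ ℝ (fun (A : C(K, G)) (γ : C(K, E)) ↦
      (⟨fun s ↦ B (A s) (γ s), by fun_prop⟩ : C(K, F)))
      (fun A B γ ↦ by ext; simp) (fun c A γ ↦ by ext; simp) (fun A γ δ ↦ by ext; simp)
      (fun c A γ ↦ by ext; simp)) ‖B‖
    (fun A γ ↦ by
      rw [ContinuousMap.norm_le _ (by positivity)]
      intro s
      exact (B (A s)).le_of_opNorm_le_of_le
        (B.le_opNorm_of_le (A.norm_coe_le_norm s)) (γ.norm_coe_le_norm s))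

@[simp] theorem ContinuousMap.bilinear_apply {E F G : Type*} [NormedAddCommGroup E]
    [NormedSpace ℝ E] [NormedAddCommGroup F] [NormedSpace ℝ F] [NormedAddCommGroup G]
    [NormedSpace ℝ G] (B : G →L[ℝ] E →L[ℝ] F) (A : C(K, G))
    (γ : C(K, E)) (s : K) : ContinuousMap.bilinear K B A γ s = B (A s) (γ s) := rfl

/-- The mean value inequality bounds the remainder at each parameter s by the oscillation of the
derivative near γ s. That oscillation is small uniformly in s because postcomposition with `f'` is
continuous for the sup norm. -/
theorem ContinuousMap.hasFDerivAt_comp_left {E F G : Type*} [NormedAddCommGroup E]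
    [NormedSpace ℝ E] [NormedAddCommGroup F] [NormedSpace ℝ F] [NormedAddCommGroup G]
    [NormedSpace ℝ G] (B : G →L[ℝ] E →L[ℝ] F) (f : C(E, F)) (f' : C(E, G))
    (hf : ∀ x, HasFDerivAt f (B (f' x)) x) (γ : C(K, E)) :
    HasFDerivAt (fun γ : C(K, E) ↦ f.comp γ) (ContinuousMap.bilinear K B (f'.comp γ)) γ := by
  rw [hasFDerivAt_iff_isLittleO_nhds_zero, Asymptotics.isLittleO_iff]
  intro ε hε
  have hc : ContinuousAt (fun γ : C(K, E) ↦ f'.comp γ) γ :=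
    (ContinuousMap.continuous_postcomp f').continuousAt
  have hB : 0 < ‖B‖ + 1 := by positivity
  obtain ⟨δ, hδ, H⟩ := Metric.continuousAt_iff.1 hc (ε / (‖B‖ + 1)) (by positivity)
  filter_upwards [Metric.ball_mem_nhds (0 : C(K, E)) hδ] with h hh
  rw [ContinuousMap.norm_le _ (by positivity)]
  intro s
  have key : ∀ y ∈ Metric.ball (γ s) δ, ‖B (f' y) - B (f' (γ s))‖ ≤ ε := by
    intro y hy
    -- Translating the whole curve by the constant y - γ s turns sup-norm continuity at γ into a
    -- pointwise estimate with one δ for all s.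
    have h1 : dist (γ + ContinuousMap.const K (y - γ s)) γ < δ := by
      rw [dist_eq_norm, add_sub_cancel_left]
      refine lt_of_le_of_lt ?_ (mem_ball_iff_norm.1 hy)
      rw [ContinuousMap.norm_le _ (norm_nonneg _)]
      intro s
      simp
    have h2 := H h1
    rw [dist_eq_norm] at h2
    have h3 := (ContinuousMap.norm_coe_le_norm (f'.comp (γ + ContinuousMap.const K (y - γ s))
      - f'.comp γ) s).trans h2.le
    have h4 : ‖f' y - f' (γ s)‖ ≤ ε / (‖B‖ + 1) := by simpa using h3
    rw [← map_sub]
    calc ‖B (f' y - f' (γ s))‖ ≤ ‖B‖ * (ε / (‖B‖ + 1)) := B.le_opNorm_of_le h4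
      _ ≤ (‖B‖ + 1) * (ε / (‖B‖ + 1)) := by gcongr; linarith
      _ = ε := by field_simp
  have hs : ‖h s‖ < δ := (h.norm_coe_le_norm s).trans_lt (by simpa using hh)
  have h1 := (convex_ball (γ s) δ).norm_image_sub_le_of_norm_hasFDerivWithin_le'
    (f := f) (f' := fun y ↦ B (f' y)) (φ := B (f' (γ s))) (C := ε)
    (fun y _ ↦ (hf y).hasFDerivWithinAt) key (Metric.mem_ball_self hδ)
    (show γ s + h s ∈ Metric.ball (γ s) δ by simpa using hs)
  have h2 : ‖f (γ s + h s) - f (γ s) - B (f' (γ s)) (h s)‖ ≤ ε * ‖h s‖ := by simpa using h1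
  exact h2.trans (mul_le_mul_of_nonneg_left (h.norm_coe_le_norm s) hε.le)

/-- The derivative is again a superposition operator, that of the derivative of `f`, followed by a
bounded linear map, so induction on the order applies. The induction passes from `F` to `E →L[ℝ] F`,
hence the common universe. -/
theorem ContinuousMap.contDiff_comp_left_nat {E : Type u} [NormedAddCommGroup E] [NormedSpace ℝ E]
    (n : ℕ) : ∀ {F : Type u} [NormedAddCommGroup F] [NormedSpace ℝ F] (f : C(E, F)),
    ContDiff ℝ n f → ContDiff ℝ n (fun γ : C(K, E) ↦ f.comp γ) := by
  induction n with
  | zero =>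
    intro F _ _ f _
    exact contDiff_zero.2 (ContinuousMap.continuous_postcomp f)
  | succ n ih =>
    intro F _ _ f hf
    have hf' := hf
    rw [Nat.cast_succ, contDiff_succ_iff_hasFDerivAt] at hf' ⊢
    obtain ⟨f', h1, h2⟩ := hf'
    exact ⟨_, (ContinuousMap.bilinear K (ContinuousLinearMap.id ℝ (E →L[ℝ] F))).contDiff.comp
      (ih ⟨f', h1.continuous⟩ h1),
      ContinuousMap.hasFDerivAt_comp_left (.id ℝ (E →L[ℝ] F)) f ⟨f', h1.continuous⟩ h2⟩

/-- The superposition operator of a smooth map is smooth for the topology of uniform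
convergence. -/
theorem ContinuousMap.contDiff_comp_left {E F : Type u} [NormedAddCommGroup E] [NormedSpace ℝ E]
    [NormedAddCommGroup F] [NormedSpace ℝ F] (f : C(E, F)) (hf : ContDiff ℝ ∞ f) :
    ContDiff ℝ ∞ (fun γ : C(K, E) ↦ f.comp γ) :=
  contDiff_infty.2 fun n ↦ ContinuousMap.contDiff_comp_left_nat n f
    (hf.of_le (by exact_mod_cast le_top))

end Nemytskii

/-! ### Smooth local inverses and functions of a regular function -/

section LocalInverse

/-- The inverse function theorem for smooth maps between Banach spaces, with a local inverse which
is smooth on a whole neighbourhood. -/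
theorem exists_openPartialHomeomorph_contDiffOn_symm {E F : Type*} [NormedAddCommGroup E]
    [NormedSpace ℝ E] [CompleteSpace E] [NormedAddCommGroup F] [NormedSpace ℝ F]
    {f : E → F} {U : Set E} (hU : IsOpen U)
    (hf : ContDiffOn ℝ ∞ f U) {p : E} (hp : p ∈ U) (f' : E ≃L[ℝ] F)
    (hf' : HasFDerivAt f (f' : E →L[ℝ] F) p) :
    ∃ Ψ : OpenPartialHomeomorph E F, p ∈ Ψ.source ∧ Ψ.source ⊆ U ∧ (Ψ : E → F) = f ∧
      ContDiffOn ℝ ∞ Ψ.symm Ψ.target := by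
  have hfp : ContDiffAt ℝ ∞ f p := hf.contDiffAt (hU.mem_nhds hp)
  let Ψ₀ := hfp.toOpenPartialHomeomorph f hf' (by simp)
  -- Smoothness of the inverse at a point needs an invertible derivative at its preimage. Invertible
  -- operators form an open set, so restricting to `S` gives smoothness on the whole target.
  let S : Set E := U ∩ fderiv ℝ f ⁻¹' Set.range ((↑) : (E ≃L[ℝ] F) → E →L[ℝ] F)
  have hS : IsOpen S :=
    (hf.continuousOn_fderiv_of_isOpen hU (by simp)).isOpen_inter_preimage hU
      (ContinuousLinearEquiv.isOpen (𝕜 := ℝ) (E := E) (F := F))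
  have hpS : p ∈ S := ⟨hp, f', hf'.fderiv.symm⟩
  refine ⟨Ψ₀.restrOpen S hS, ?_, ?_, rfl, ?_⟩
  · exact ⟨hfp.mem_toOpenPartialHomeomorph_source hf' (by simp), hpS⟩
  · exact fun x hx ↦ hx.2.1
  · intro y hy
    have hx : (Ψ₀.restrOpen S hS).symm y ∈ S := ((Ψ₀.restrOpen S hS).map_target hy).2
    obtain ⟨hxU, e, he⟩ := hx
    refine (OpenPartialHomeomorph.contDiffAt_symm (f₀' := e) _ hy ?_ ?_).contDiffWithinAt
    · rw [he]
      exact ((hf.contDiffAt (hU.mem_nhds hxU)).differentiableAt (by simp)).hasFDerivAt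
    · exact hf.contDiffAt (hU.mem_nhds hxU)

/-- A smooth map on an open set agrees near a given point with a globally smooth map. -/
theorem exists_contDiff_eqOn_nhds {E F : Type*} [NormedAddCommGroup E] [NormedSpace ℝ E]
    [HasContDiffBump E] [NormedAddCommGroup F] [NormedSpace ℝ F] {f : E → F}
    {U : Set E} (hU : IsOpen U) (hf : ContDiffOn ℝ ∞ f U) {p : E} (hp : p ∈ U) :
    ∃ (g : E → F) (V : Set E), ContDiff ℝ ∞ g ∧ IsOpen V ∧ p ∈ V ∧ V ⊆ U ∧ Set.EqOn g f V := by
  obtain ⟨r, hr, hrU⟩ := Metric.isOpen_iff.1 hU p hp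
  let χ : ContDiffBump p := ⟨r / 4, r / 2, by linarith, by linarith⟩
  have hsupp : tsupport χ ⊆ U := by
    refine χ.tsupport_eq.subset.trans (Set.Subset.trans ?_ hrU)
    exact Metric.closedBall_subset_ball (by show r / 2 < r; linarith)
  refine ⟨fun x ↦ χ x • f x, Metric.ball p (r / 4), ?_, Metric.isOpen_ball,
    Metric.mem_ball_self (by linarith),
    (Metric.ball_subset_ball (by linarith)).trans hrU, fun x hx ↦ ?_⟩
  · rw [contDiff_iff_contDiffAt]
    intro x
    by_cases hx : x ∈ U
    · exact χ.contDiffAt.smul (hf.contDiffAt (hU.mem_nhds hx))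
    · have h0 : (fun x ↦ χ x • f x) =ᶠ[𝓝 x] fun _ ↦ (0 : F) := by
        have : (tsupport χ)ᶜ ∈ 𝓝 x :=
          (isClosed_tsupport _).isOpen_compl.mem_nhds fun h ↦ hx (hsupp h)
        filter_upwards [this] with y hy
        rw [image_eq_zero_of_notMem_tsupport hy, zero_smul]
      exact contDiffAt_const.congr_of_eventuallyEq h0
  · have : χ x = 1 := χ.one_of_mem_closedBall (Metric.ball_subset_closedBall hx)
    simp [this]

/-- Near a regular point of a smooth function `α`, a smooth function whose differential is
everywhere proportional to that of `α` is a smooth function of `α`. -/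
theorem exists_eq_comp_of_fderiv_eq_smul {E : Type*} [NormedAddCommGroup E]
    [NormedSpace ℝ E] [CompleteSpace E] {α : E → ℝ} {U : Set E} (hU : IsOpen U)
    (hα : ContDiffOn ℝ ∞ α U) {p : E} (hp : p ∈ U) (hdα : fderiv ℝ α p ≠ 0) :
    ∃ V : Set E, IsOpen V ∧ p ∈ V ∧ V ⊆ U ∧ ∀ k : E → ℝ, ContDiffOn ℝ ∞ k V →
      (∀ x ∈ V, ∀ X Y, fderiv ℝ k x X * fderiv ℝ α x Y = fderiv ℝ k x Y * fderiv ℝ α x X) →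
      ∃ φ : ℝ → ℝ, ContDiffOn ℝ ∞ φ (α '' V) ∧ ∀ y ∈ V, k y = φ (α y) := by
  obtain ⟨e, he⟩ : ∃ e, fderiv ℝ α p e = 1 := by
    obtain ⟨w, hw⟩ := DFunLike.ne_iff.1 hdα
    exact ⟨(fderiv ℝ α p w)⁻¹ • w, by
      rw [map_smul, smul_eq_mul]; exact inv_mul_cancel₀ (by simpa using hw)⟩
  set l := fderiv ℝ α p with hl
  -- This chart turns `α` into the linear functional `l`; its derivative at `p` is the identity.
  let Φ : E → E := fun y ↦ y + (α y - l y) • e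
  have hlΦ : ∀ y, l (Φ y) = α y := fun y ↦ by simp [Φ, he]
  have hΦs : ContDiffOn ℝ ∞ Φ U :=
    contDiffOn_id.add ((hα.sub l.contDiff.contDiffOn).smul contDiffOn_const)
  have hαp : HasFDerivAt α l p :=
    ((hα.contDiffAt (hU.mem_nhds hp)).differentiableAt (by simp)).hasFDerivAt
  have hΦp : HasFDerivAt Φ ((ContinuousLinearEquiv.refl ℝ E : E ≃L[ℝ] E) : E →L[ℝ] E) p := by
    convert! (hasFDerivAt_id p).add ((hαp.sub l.hasFDerivAt).smul_const e) using 1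
    ext w
    simp
  obtain ⟨Ψ, hpΨ, hΨU, hΨ, hΨs⟩ := exists_openPartialHomeomorph_contDiffOn_symm hU hΦs hp _ hΦp
  set c := Φ p with hc
  have hcT : c ∈ Ψ.target := by rw [hc, ← hΨ]; exact Ψ.map_source hpΨ
  obtain ⟨ρ, hρ, hρT⟩ := Metric.isOpen_iff.1 Ψ.open_target c hcT
  obtain ⟨r, hr, hrρ⟩ : ∃ r : ℝ, 0 < r ∧ r * (1 + ‖e‖) < ρ := by
    refine ⟨ρ / (2 * (1 + ‖e‖)), by positivity, ?_⟩
    have : ρ / (2 * (1 + ‖e‖)) * (1 + ‖e‖) = ρ / 2 := by field_simp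
    linarith
  let R : E →L[ℝ] E := ContinuousLinearMap.id ℝ E - l.smulRight e
  have hR : ∀ w, R w = w - l w • e := fun w ↦ by simp [R]
  -- A convex product neighbourhood for the splitting along ker l and e: the projection of each of
  -- its points to the line c + ℝe stays inside. The choice of `r` keeps it in the target.
  let B : Set E := {z | l z ∈ Metric.ball (l c) r} ∩ {z | R z ∈ Metric.ball (R c) r}
  have hBo : IsOpen B := (Metric.isOpen_ball.preimage l.continuous).inter
    (Metric.isOpen_ball.preimage R.continuous)
  have hBc : Convex ℝ B := ((convex_ball _ _).linear_preimage l.toLinearMap).inter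
    ((convex_ball _ _).linear_preimage R.toLinearMap)
  have hcB : c ∈ B := ⟨Metric.mem_ball_self hr, Metric.mem_ball_self hr⟩
  have hBT : B ⊆ Ψ.target := by
    refine fun z hz ↦ hρT ?_
    have h1 : ‖l (z - c)‖ < r := by rw [map_sub]; exact mem_ball_iff_norm.1 hz.1
    have h2 : ‖R (z - c)‖ < r := by rw [map_sub]; exact mem_ball_iff_norm.1 hz.2
    rw [mem_ball_iff_norm]
    have h3 : z - c = R (z - c) + l (z - c) • e := by rw [hR]; abel
    calc ‖z - c‖ = ‖R (z - c) + l (z - c) • e‖ := congrArg norm h3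
      _ ≤ ‖R (z - c)‖ + ‖l (z - c) • e‖ := norm_add_le _ _
      _ ≤ r + r * ‖e‖ := by rw [norm_smul]; gcongr
      _ < ρ := by linarith
  have hproj : ∀ z ∈ B, c + (l z - l c) • e ∈ B := by
    intro z hz
    refine ⟨?_, ?_⟩
    · have h1 : l (c + (l z - l c) • e) = l z := by simp [he]
      rw [Set.mem_ofPred_eq, h1]; exact hz.1
    · have h1 : R (c + (l z - l c) • e) = R c := by simp [hR, he]; module
      rw [Set.mem_ofPred_eq, h1]; exact Metric.mem_ball_self hr
  have hαsymm : ∀ z ∈ Ψ.target, α (Ψ.symm z) = l z := fun z hz ↦ by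
    rw [← hlΦ, ← hΨ, Ψ.right_inv hz]
  refine ⟨Ψ.source ∩ Ψ ⁻¹' B, Ψ.isOpen_inter_preimage hBo, ⟨hpΨ, by rw [hΨ]; exact hcB⟩,
    fun x hx ↦ hΨU hx.1, fun k hk hkα ↦ ?_⟩
  have hVo : IsOpen (Ψ.source ∩ Ψ ⁻¹' B) := Ψ.isOpen_inter_preimage hBo
  have hmaps : ∀ z ∈ B, Ψ.symm z ∈ Ψ.source ∩ Ψ ⁻¹' B := fun z hz ↦
    ⟨Ψ.map_target (hBT hz), by rw [Set.mem_preimage, Ψ.right_inv (hBT hz)]; exact hz⟩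
  have hK : ContDiffOn ℝ ∞ (k ∘ Ψ.symm) B := hk.comp (hΨs.mono hBT) hmaps
  -- In the straightened chart the proportionality hypothesis, applied to the images of w and e,
  -- says that k has no derivative along ker l.
  have hKd : ∀ z ∈ B, ∀ w, l w = 0 → fderiv ℝ (k ∘ Ψ.symm) z w = 0 := by
    intro z hz w hw
    have hS := ((hΨs.contDiffAt (Ψ.open_target.mem_nhds (hBT hz))).differentiableAt
      (by simp)).hasFDerivAt
    have hV := hmaps z hz
    have hk' := ((hk.contDiffAt (hVo.mem_nhds hV)).differentiableAt (by simp)).hasFDerivAt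
    have hα' := ((hα.contDiffAt (hU.mem_nhds (hΨU hV.1))).differentiableAt (by simp)).hasFDerivAt
    have hcomp : HasFDerivAt (α ∘ Ψ.symm) l z :=
      l.hasFDerivAt.congr_of_eventuallyEq (by
        filter_upwards [Ψ.open_target.mem_nhds (hBT hz)] with z' hz' using hαsymm z' hz')
    have h1 : ∀ v, fderiv ℝ α (Ψ.symm z) (fderiv ℝ Ψ.symm z v) = l v := fun v ↦
      congr($((hα'.comp z hS).unique hcomp) v)
    rw [(hk'.comp z hS).fderiv]
    have h2 := hkα _ hV (fderiv ℝ Ψ.symm z w) (fderiv ℝ Ψ.symm z e)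
    rw [h1, h1, hw, he, mul_one, mul_zero] at h2
    exact h2
  have hconst : ∀ z ∈ B, (k ∘ Ψ.symm) z = (k ∘ Ψ.symm) (c + (l z - l c) • e) := by
    intro z hz
    set z' := c + (l z - l c) • e with hz'
    have hlz : l (z - z') = 0 := by simp [hz', he]
    have hseg : ∀ s ∈ Set.Icc (0 : ℝ) 1, z' + s • (z - z') ∈ B := fun s hs ↦
      hBc.add_smul_sub_mem (hproj z hz) hz hs
    have hder : ∀ s ∈ Set.Icc (0 : ℝ) 1,
        HasDerivAt (fun s : ℝ ↦ (k ∘ Ψ.symm) (z' + s • (z - z'))) 0 s := by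
      intro s hs
      have h1 := ((hK.contDiffAt (hBo.mem_nhds (hseg s hs))).differentiableAt
        (by simp)).hasFDerivAt
      have h2 : HasDerivAt (fun s : ℝ ↦ z' + s • (z - z')) (z - z') s := by
        simpa using ((hasDerivAt_id s).smul_const (z - z')).const_add z'
      have h3 := h1.comp_hasDerivAt s h2
      rwa [hKd _ (hseg s hs) _ hlz] at h3
    have := constant_of_has_deriv_right_zero
      (fun s hs ↦ (hder s hs).continuousAt.continuousWithinAt)
      (fun s hs ↦ (hder s (Set.Ico_subset_Icc_self hs)).hasDerivWithinAt) 1 (by simp)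
    simpa using this
  -- φ is k read off along the line through c in the direction e; constancy along ker l extends the
  -- identity to the whole neighbourhood.
  refine ⟨fun t ↦ (k ∘ Ψ.symm) (c + (t - l c) • e), ?_, fun y hy ↦ ?_⟩
  · refine hK.comp (s := α '' (Ψ.source ∩ Ψ ⁻¹' B)) (by fun_prop) ?_
    rintro _ ⟨y, hy, rfl⟩
    have := hproj _ hy.2
    rwa [hΨ, hlΦ] at this
  · have := hconst _ hy.2
    rw [hΨ, hlΦ, ← hΨ] at this
    show k y = (k ∘ Ψ.symm) (c + (α y - l c) • e)
    rw [← this, Function.comp_apply, Ψ.left_inv hy.1]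

end LocalInverse

/-! ### The Frobenius theorem for one-forms -/

section Frobenius

/-- The indefinite integral of a continuous function on the unit interval, times a vector. -/
def integralSmul {E : Type*} [NormedAddCommGroup E] [NormedSpace ℝ E] (e : E) :
    C(Set.Icc (0 : ℝ) 1, ℝ) →L[ℝ] C(Set.Icc (0 : ℝ) 1, E) :=
  LinearMap.mkContinuous
    { toFun c := ⟨fun s ↦ (∫ t in (0 : ℝ)..s, c (Set.projIcc 0 1 zero_le_one t)) • e, by
        have : Continuous fun t ↦ c (Set.projIcc 0 1 zero_le_one t) :=
          c.continuous.comp continuous_projIcc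
        have h := intervalIntegral.continuous_primitive
          (fun a b ↦ this.intervalIntegrable (μ := MeasureTheory.volume) a b) 0
        exact (h.comp continuous_subtype_val).smul continuous_const⟩
      map_add' c d := by
        ext s
        have (c : C(Set.Icc (0 : ℝ) 1, ℝ)) :
            Continuous fun t ↦ c (Set.projIcc 0 1 zero_le_one t) :=
          c.continuous.comp continuous_projIcc
        simp [intervalIntegral.integral_add ((this c).intervalIntegrable _ _)
          ((this d).intervalIntegrable _ _), add_smul]
      map_smul' r c := by
        ext s
        simp [mul_smul] } ‖e‖
    (fun c ↦ by
      rw [ContinuousMap.norm_le _ (by positivity)]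
      intro s
      have h1 : ‖∫ t in (0 : ℝ)..s, c (Set.projIcc 0 1 zero_le_one t)‖ ≤ ‖c‖ * |(s : ℝ) - 0| :=
        intervalIntegral.norm_integral_le_of_norm_le_const fun t _ ↦ c.norm_coe_le_norm _
      have h2 : |(s : ℝ) - 0| ≤ 1 := by rw [sub_zero, abs_of_nonneg s.2.1]; exact s.2.2
      show ‖(∫ t in (0 : ℝ)..s, c (Set.projIcc 0 1 zero_le_one t)) • e‖ ≤ ‖e‖ * ‖c‖
      rw [norm_smul, mul_comm]
      gcongr
      exact h1.trans (mul_le_of_le_one_right (norm_nonneg _) h2))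

@[simp] theorem integralSmul_apply {E : Type*} [NormedAddCommGroup E] [NormedSpace ℝ E] (e : E)
    (c : C(Set.Icc (0 : ℝ) 1, ℝ)) (s : Set.Icc (0 : ℝ) 1) :
    integralSmul e c s = (∫ t in (0 : ℝ)..s, c (Set.projIcc 0 1 zero_le_one t)) • e := rfl

/-- The family of curves `s ↦ A q + s • B q` depending linearly on `q`. -/
def affineCurve {E F : Type*} [NormedAddCommGroup E] [NormedSpace ℝ E] [NormedAddCommGroup F]
    [NormedSpace ℝ F] (A B : E →L[ℝ] F) : E →L[ℝ] C(Set.Icc (0 : ℝ) 1, F) :=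
  LinearMap.mkContinuous
    { toFun q := ⟨fun s ↦ A q + (s : ℝ) • B q, by fun_prop⟩
      map_add' q r := by ext s; simp; abel
      map_smul' c q := by ext s; simp [smul_comm c] } (‖A‖ + ‖B‖)
    (fun q ↦ by
      rw [ContinuousMap.norm_le _ (by positivity)]
      intro s
      show ‖A q + (s : ℝ) • B q‖ ≤ _
      have h2 : ‖(s : ℝ)‖ ≤ 1 := by
        rw [Real.norm_eq_abs, abs_of_nonneg s.2.1]; exact s.2.2
      calc ‖A q + (s : ℝ) • B q‖ ≤ ‖A q‖ + ‖(s : ℝ) • B q‖ := norm_add_le _ _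
        _ ≤ ‖A‖ * ‖q‖ + ‖B‖ * ‖q‖ := by
          rw [norm_smul]
          exact add_le_add (A.le_opNorm q)
            ((mul_le_of_le_one_left (norm_nonneg _) h2).trans (B.le_opNorm q))
        _ = (‖A‖ + ‖B‖) * ‖q‖ := by ring)

@[simp] theorem affineCurve_apply {E F : Type*} [NormedAddCommGroup E] [NormedSpace ℝ E]
    [NormedAddCommGroup F] [NormedSpace ℝ F] (A B : E →L[ℝ] F) (q : E) (s : Set.Icc (0 : ℝ) 1) :
    affineCurve A B q s = A q + (s : ℝ) • B q := rfl

theorem hasFDerivAt_bilinear_comp {K : Type*} [TopologicalSpace K] [CompactSpace K]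
    {Z E F G₁ G₂ : Type*} [NormedAddCommGroup Z] [NormedSpace ℝ Z]
    [NormedAddCommGroup E] [NormedSpace ℝ E] [NormedAddCommGroup F] [NormedSpace ℝ F]
    [NormedAddCommGroup G₁] [NormedSpace ℝ G₁] [NormedAddCommGroup G₂] [NormedSpace ℝ G₂]
    (B₁ : G₁ →L[ℝ] E →L[ℝ] F) (B₂ : G₂ →L[ℝ] E →L[ℝ] G₁) (f : C(E, G₁)) (f' : C(E, G₂))
    (hf : ∀ x, HasFDerivAt f (B₂ (f' x)) x) (c : Z →L[ℝ] C(K, E)) (z : Z × C(K, E)) :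
    HasFDerivAt (fun z : Z × C(K, E) ↦ ContinuousMap.bilinear K B₁ (f.comp z.2) (c z.1))
      ((ContinuousMap.bilinear K B₁ (f.comp z.2)).comp (c.comp (.fst ℝ Z C(K, E))) +
        ((ContinuousMap.bilinear K B₁).flip (c z.1)).comp
          ((ContinuousMap.bilinear K B₂ (f'.comp z.2)).comp (.snd ℝ Z C(K, E)))) z := by
  have h1 := ContinuousMap.hasFDerivAt_comp_left (K := K) B₂ f f' hf z.2
  have h2 := (ContinuousMap.bilinear K B₁).hasFDerivAt.comp z (h1.comp z hasFDerivAt_snd)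
  exact h2.clm_apply (c.hasFDerivAt.comp z hasFDerivAt_fst)

/-- The exterior derivative of a one-form on a normed space. -/
def extDNormed {E : Type*} [NormedAddCommGroup E] [NormedSpace ℝ E] (a : E → E →L[ℝ] ℝ) (x : E)
    (X Y : E) : ℝ := fderiv ℝ a x X Y - fderiv ℝ a x Y X

set_option synthInstance.maxHeartbeats 100000 in
/-- A smooth family of curves in the kernel of a one-form `x ↦ B₁ (a x)` which is normalized by
`B₁ (a x) e = 1`: the curve with parameter `q` starts at `p + l q • e`, and its velocity is the
projection of `q` along `e` to the kernel of the form. The derivatives of the curves with respect to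
`q` satisfy the linearized equation. -/
theorem exists_smooth_family_horizontal_curves {E V W : Type u} [NormedAddCommGroup E]
    [NormedSpace ℝ E] [CompleteSpace E] [NormedAddCommGroup V] [NormedSpace ℝ V]
    [NormedAddCommGroup W] [NormedSpace ℝ W] (B₁ : V →L[ℝ] E →L[ℝ] ℝ) (B₂ : W →L[ℝ] E →L[ℝ] V)
    {a : E → V} (ha : ContDiff ℝ ∞ a) {a' : E → W} (ha' : Continuous a')
    (haa' : ∀ x, HasFDerivAt a (B₂ (a' x)) x) (p e : E) (l : E →L[ℝ] ℝ) :
    ∃ (Q : Set E) (x : E → C(Set.Icc (0 : ℝ) 1, E)), IsOpen Q ∧ 0 ∈ Q ∧ ContDiffOn ℝ ∞ x Q ∧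
      x 0 = ContinuousMap.const _ p ∧
      (∀ q ∈ Q, ∀ s : Set.Icc (0 : ℝ) 1, x q s = p + l q • e + (s : ℝ) • (q - l q • e) -
        (∫ t in (0 : ℝ)..s, B₁ (a (x q (Set.projIcc 0 1 zero_le_one t))) (q - l q • e)) • e) ∧
      (∀ q ∈ Q, ∀ δ, ∀ s : Set.Icc (0 : ℝ) 1,
        fderiv ℝ x q δ s = l δ • e + (s : ℝ) • (δ - l δ • e) -
        (∫ t in (0 : ℝ)..s, (B₁ (B₂ (a' (x q (Set.projIcc 0 1 zero_le_one t)))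
            (fderiv ℝ x q δ (Set.projIcc 0 1 zero_le_one t))) (q - l q • e) +
          B₁ (a (x q (Set.projIcc 0 1 zero_le_one t))) (δ - l δ • e))) • e) := by
  let A : E →L[ℝ] E := l.smulRight e
  let P : E →L[ℝ] E := ContinuousLinearMap.id ℝ E - A
  have hP : ∀ q, P q = q - l q • e := fun q ↦ by simp [P, A]
  let aC : C(E, V) := ⟨a, ha.continuous⟩
  let a'C : C(E, W) := ⟨a', ha'⟩
  let bil := ContinuousMap.bilinear (Set.Icc (0 : ℝ) 1) B₁
  let bil' := ContinuousMap.bilinear (Set.Icc (0 : ℝ) 1) B₂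
  let constP : E →L[ℝ] C(Set.Icc (0 : ℝ) 1, E) := affineCurve P 0
  let N : E × C(Set.Icc (0 : ℝ) 1, E) → C(Set.Icc (0 : ℝ) 1, ℝ) := fun z ↦ bil (aC.comp z.2) (constP z.1)
  have hNs : ContDiff ℝ ∞ N :=
    (bil.contDiff.comp ((ContinuousMap.contDiff_comp_left aC ha).comp contDiff_snd)).clm_apply
      (constP.contDiff.comp contDiff_fst)
  let c₀ : C(Set.Icc (0 : ℝ) 1, E) := ContinuousMap.const _ p
  -- The zeros of `G` are the pairs (q, curve) that satisfy the integral equation.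
  let G : E × C(Set.Icc (0 : ℝ) 1, E) → C(Set.Icc (0 : ℝ) 1, E) := fun z ↦ z.2 - c₀ - affineCurve A P z.1 + integralSmul e (N z)
  have hGs : ContDiff ℝ ∞ G := by
    refine ((contDiff_snd.sub contDiff_const).sub ?_).add ?_
    · exact (affineCurve A P).contDiff.comp contDiff_fst
    · exact (integralSmul e).contDiff.comp hNs
  let H : E × C(Set.Icc (0 : ℝ) 1, E) → E × C(Set.Icc (0 : ℝ) 1, E) := fun z ↦ (z.1, G z)
  have hHs : ContDiff ℝ ∞ H := contDiff_fst.prodMk hGs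
  let N' : E × C(Set.Icc (0 : ℝ) 1, E) → E × C(Set.Icc (0 : ℝ) 1, E) →L[ℝ] C(Set.Icc (0 : ℝ) 1, ℝ) := fun z ↦
    (bil (aC.comp z.2)).comp (constP.comp (.fst ℝ E C(Set.Icc (0 : ℝ) 1, E))) +
      (bil.flip (constP z.1)).comp ((bil' (a'C.comp z.2)).comp (.snd ℝ E C(Set.Icc (0 : ℝ) 1, E)))
  have hN : ∀ z, HasFDerivAt N (N' z) z := fun z ↦
    hasFDerivAt_bilinear_comp B₁ B₂ aC a'C haa' constP z
  let G' : E × C(Set.Icc (0 : ℝ) 1, E) → E × C(Set.Icc (0 : ℝ) 1, E) →L[ℝ] C(Set.Icc (0 : ℝ) 1, E) := fun z ↦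
    (ContinuousLinearMap.snd ℝ E C(Set.Icc (0 : ℝ) 1, E)) - (affineCurve A P).comp (.fst ℝ E C(Set.Icc (0 : ℝ) 1, E)) +
      (integralSmul e).comp (N' z)
  have hG : ∀ z, HasFDerivAt G (G' z) z := fun z ↦
    ((hasFDerivAt_snd.sub_const c₀).sub ((affineCurve A P).hasFDerivAt.comp z hasFDerivAt_fst)).add
      ((integralSmul e).hasFDerivAt.comp z (hN z))
  -- At q = 0 the integrand vanishes for every curve, so the partial derivative of `G` in the curve
  -- is the identity. The derivative of `H` is then triangular, with `M` as its only off-diagonal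
  -- entry, and invertible without any contraction estimate.
  let M : E →L[ℝ] C(Set.Icc (0 : ℝ) 1, E) := (integralSmul e).comp ((bil (aC.comp c₀)).comp constP) -
    affineCurve A P
  let S : (E × C(Set.Icc (0 : ℝ) 1, E)) ≃L[ℝ] E × C(Set.Icc (0 : ℝ) 1, E) :=
    ContinuousLinearEquiv.skewProd (.refl ℝ E) (.refl ℝ C(Set.Icc (0 : ℝ) 1, E)) M
  have hH0 : HasFDerivAt H (S : E × C(Set.Icc (0 : ℝ) 1, E) →L[ℝ] E × C(Set.Icc (0 : ℝ) 1, E)) (0, c₀) := by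
    refine (hasFDerivAt_fst.prodMk (hG (0, c₀))).congr_fderiv ?_
    refine ContinuousLinearMap.ext fun z ↦ Prod.ext ?_ ?_
    · simp [S]
    · simp [S, M, G', N']
      abel
  obtain ⟨Ψ, h0Ψ, -, hΨ, hΨs⟩ := exists_openPartialHomeomorph_contDiffOn_symm isOpen_univ
    hHs.contDiffOn (Set.mem_univ (0, c₀)) S hH0
  have hH00 : H (0, c₀) = (0, 0) := by simp [H, G, N]
  let Q : Set E := (fun q ↦ (q, (0 : C(Set.Icc (0 : ℝ) 1, E)))) ⁻¹' Ψ.target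
  let x : E → C(Set.Icc (0 : ℝ) 1, E) := fun q ↦ (Ψ.symm (q, 0)).2
  have hQo : IsOpen Q := Ψ.open_target.preimage (by fun_prop)
  have hxs : ContDiffOn ℝ ∞ x Q :=
    contDiff_snd.comp_contDiffOn (hΨs.comp (contDiff_prodMk_left 0).contDiffOn fun q hq ↦ hq)
  have hHx : ∀ q ∈ Q, H (q, x q) = (q, 0) := by
    intro q hq
    have h1 : H (Ψ.symm (q, 0)) = (q, 0) := by rw [← hΨ]; exact Ψ.right_inv hq
    have h2 : (Ψ.symm (q, 0)).1 = q := congrArg Prod.fst h1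
    have h3 : Ψ.symm (q, 0) = (q, x q) := Prod.ext h2 rfl
    rwa [h3] at h1
  have hGx : ∀ q ∈ Q, G (q, x q) = 0 := fun q hq ↦ congrArg Prod.snd (hHx q hq)
  refine ⟨Q, x, hQo, ?_, hxs, ?_, fun q hq s ↦ ?_, fun q hq δ s ↦ ?_⟩
  · have := Ψ.map_source h0Ψ
    rwa [hΨ, hH00] at this
  · have := Ψ.left_inv h0Ψ
    rw [hΨ, hH00] at this
    exact congrArg Prod.snd this
  · have h1 := congrArg (fun c : C(Set.Icc (0 : ℝ) 1, E) ↦ c s) (hGx q hq)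
    simp only [G, ContinuousMap.add_apply, ContinuousMap.sub_apply, affineCurve_apply,
      integralSmul_apply, ContinuousMap.zero_apply] at h1
    have h2 : x q s = c₀ s + (A q + (s : ℝ) • P q) -
        (∫ t in (0 : ℝ)..s, N (q, x q) (Set.projIcc 0 1 zero_le_one t)) • e := by
      rw [eq_sub_iff_add_eq, ← sub_eq_zero, ← h1]; abel
    rw [h2]
    simp [N, bil, constP, aC, c₀, hP, A]
    abel
  · have hx' : HasFDerivAt x (fderiv ℝ x q) q :=
      ((hxs.contDiffAt (hQo.mem_nhds hq)).differentiableAt (by simp)).hasFDerivAt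
    have h0 : HasFDerivAt (fun q ↦ G (q, x q)) (0 : E →L[ℝ] C(Set.Icc (0 : ℝ) 1, E)) q :=
      (hasFDerivAt_const (0 : C(Set.Icc (0 : ℝ) 1, E)) q).congr_of_eventuallyEq (by
        filter_upwards [hQo.mem_nhds hq] with r hr using hGx r hr)
    have h1 := ((hG (q, x q)).comp q ((hasFDerivAt_id q).prodMk hx')).unique h0
    have h1 := congrArg (fun c : C(Set.Icc (0 : ℝ) 1, E) ↦ c s) (congr($h1 δ))
    simp only [G', ContinuousLinearMap.comp_apply, add_apply,
      sub_apply, ContinuousLinearMap.prod_apply,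
      ContinuousMap.add_apply, ContinuousMap.sub_apply, affineCurve_apply,
      integralSmul_apply, ContinuousMap.zero_apply, zero_apply,
      ContinuousLinearMap.coe_snd', ContinuousLinearMap.coe_fst', ContinuousLinearMap.id_apply]
      at h1
    have h2 : fderiv ℝ x q δ s = (A δ + (s : ℝ) • P δ) -
        (∫ t in (0 : ℝ)..s, N' (q, x q) (δ, fderiv ℝ x q δ) (Set.projIcc 0 1 zero_le_one t)) •
          e := by
      rw [eq_sub_iff_add_eq, ← sub_eq_zero, ← h1]; abel
    have h3 : ∀ t, N' (q, x q) (δ, fderiv ℝ x q δ) t =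
        B₁ (B₂ (a' (x q t)) (fderiv ℝ x q δ t)) (q - l q • e) +
          B₁ (a (x q t)) (δ - l δ • e) := by
      intro t
      simp [N', bil, bil', constP, aC, a'C, hP]
      abel
    rw [h2]
    simp only [h3, hP, A, ContinuousLinearMap.smulRight_apply]

/-- The function C = a(x)(y) has derivative da(x', y). Integrability evaluated on (e, x', y), with
a(e) = 1 and a(x') = 0, turns this into C' = -da(e, x') C, so C(0) = 0 forces C = 0. Thus variations
of horizontal curves that start horizontally remain horizontal. -/
theorem extDNormed_eq_zero_along_curve {E : Type u} [NormedAddCommGroup E]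
    [NormedSpace ℝ E] {a : E → E →L[ℝ] ℝ} (ha : ContDiff ℝ ∞ a) {e : E}
    {U : Set E} (hU : IsOpen U) (hae : ∀ x ∈ U, a x e = 1)
    (hint : ∀ x ∈ U, ∀ X Y Z, a x X * extDNormed a x Y Z + a x Y * extDNormed a x Z X +
      a x Z * extDNormed a x X Y = 0)
    {x y : C(Set.Icc (0 : ℝ) 1, E)} (hxU : ∀ s, x s ∈ U) {x₀ y₀ v w : E} (hy₀ : a x₀ y₀ = 0)
    (hx : ∀ s : Set.Icc (0 : ℝ) 1, x s = x₀ + (s : ℝ) • v -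
      (∫ t in (0 : ℝ)..s, a (x (Set.projIcc 0 1 zero_le_one t)) v) • e)
    (hy : ∀ s : Set.Icc (0 : ℝ) 1, y s = y₀ + (s : ℝ) • w -
      (∫ t in (0 : ℝ)..s, (fderiv ℝ a (x (Set.projIcc 0 1 zero_le_one t))
            (y (Set.projIcc 0 1 zero_le_one t)) v +
          a (x (Set.projIcc 0 1 zero_le_one t)) w)) • e) (s : Set.Icc (0 : ℝ) 1) :
    a (x s) (y s) = 0 := by
  have hda : ContDiff ℝ ∞ (fderiv ℝ a) := ha.fderiv_right (by simp)
  have hac : Continuous a := ha.continuous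
  have hdac : Continuous (fderiv ℝ a) := hda.continuous
  let P : ℝ → Set.Icc (0 : ℝ) 1 := Set.projIcc 0 1 zero_le_one
  have hP : Continuous P := continuous_projIcc
  have hxP : Continuous fun t ↦ x (P t) := x.continuous.comp hP
  have hyP : Continuous fun t ↦ y (P t) := y.continuous.comp hP
  have hi : Continuous fun t ↦ a (x (P t)) v := (hac.comp hxP).clm_apply continuous_const
  have hj : Continuous fun t ↦ fderiv ℝ a (x (P t)) (y (P t)) v + a (x (P t)) w :=
    (((hdac.comp hxP).clm_apply hyP).clm_apply continuous_const).add
      ((hac.comp hxP).clm_apply continuous_const)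
  let ξ : ℝ → E := fun s ↦ x₀ + s • v - (∫ t in (0 : ℝ)..s, a (x (P t)) v) • e
  let η : ℝ → E := fun s ↦ y₀ + s • w -
    (∫ t in (0 : ℝ)..s, (fderiv ℝ a (x (P t)) (y (P t)) v + a (x (P t)) w)) • e
  let ξ' : ℝ → E := fun s ↦ v - a (x (P s)) v • e
  let η' : ℝ → E := fun s ↦ w - (fderiv ℝ a (x (P s)) (y (P s)) v + a (x (P s)) w) • e
  have hξ : ∀ s, HasDerivAt ξ (ξ' s) s := by
    intro s
    have h1 := (hi.integral_hasStrictDerivAt 0 s).hasDerivAt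
    have h2 := (((hasDerivAt_id s).smul_const v).const_add x₀).sub (h1.smul_const e)
    rw [one_smul] at h2
    exact h2
  have hη : ∀ s, HasDerivAt η (η' s) s := by
    intro s
    have h1 := (hj.integral_hasStrictDerivAt 0 s).hasDerivAt
    have h2 := (((hasDerivAt_id s).smul_const w).const_add y₀).sub (h1.smul_const e)
    rw [one_smul] at h2
    exact h2
  have hξc : Continuous ξ := continuous_iff_continuousAt.2 fun s ↦ (hξ s).continuousAt
  have hξ'c : Continuous ξ' := continuous_const.sub (hi.smul continuous_const)
  have hxξ : ∀ s : Set.Icc (0 : ℝ) 1, x s = ξ s := hx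
  have hyη : ∀ s : Set.Icc (0 : ℝ) 1, y s = η s := hy
  let C : ℝ → ℝ := fun s ↦ a (ξ s) (η s)
  have hC : ∀ s, HasDerivAt C (fderiv ℝ a (ξ s) (ξ' s) (η s) + a (ξ s) (η' s)) s := by
    intro s
    have h1 := ((ha.differentiable (by simp)) (ξ s)).hasFDerivAt.comp_hasDerivAt s (hξ s)
    exact h1.clm_apply (hη s)
  -- Differentiating the normalization a(e) = 1.
  have hde : ∀ z ∈ U, ∀ X, fderiv ℝ a z X e = 0 := by
    intro z hz X
    have h1 : HasFDerivAt (fun z ↦ a z e) _ z :=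
      ((ha.differentiable (by simp)) z).hasFDerivAt.clm_apply (hasFDerivAt_const e z)
    have h2 : HasFDerivAt (fun z ↦ a z e) (0 : E →L[ℝ] ℝ) z :=
      (hasFDerivAt_const (1 : ℝ) z).congr_of_eventuallyEq (by
        filter_upwards [hU.mem_nhds hz] with z' hz' using hae z' hz')
    simpa using congr($(h1.unique h2) X)
  have hode : ∀ s ∈ Set.Icc (0 : ℝ) 1,
      fderiv ℝ a (ξ s) (ξ' s) (η s) + a (ξ s) (η' s) = -(extDNormed a (ξ s) e (ξ' s)) * C s := by
    intro s hs
    have hPs : P s = ⟨s, hs⟩ := Set.projIcc_of_mem zero_le_one hs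
    have h1 : x (P s) = ξ s := by rw [hPs]; exact hxξ ⟨s, hs⟩
    have h2 : y (P s) = η s := by rw [hPs]; exact hyη ⟨s, hs⟩
    have hU' : ξ s ∈ U := h1 ▸ hxU (P s)
    have he := hae _ hU'
    have hk : a (ξ s) (ξ' s) = 0 := by
      simp only [ξ', h1, map_sub, map_smul, he, smul_eq_mul, mul_one, sub_self]
    have hη'e : a (ξ s) (η' s) = -fderiv ℝ a (ξ s) (η s) v := by
      simp only [η', h1, h2, map_sub, map_smul, he, smul_eq_mul, mul_one]
      ring
    have hv : fderiv ℝ a (ξ s) (η s) (ξ' s) = fderiv ℝ a (ξ s) (η s) v := by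
      simp only [ξ', h1, map_sub, map_smul, hde _ hU', smul_zero, sub_zero]
    have h3 := hint _ hU' e (ξ' s) (η s)
    rw [he, hk] at h3
    show _ = -(extDNormed a (ξ s) e (ξ' s)) * a (ξ s) (η s)
    rw [hη'e, ← hv]
    simp only [extDNormed] at h3 ⊢
    linear_combination h3
  obtain ⟨K, hK⟩ := isCompact_Icc.exists_bound_of_continuousOn (s := Set.Icc (0 : ℝ) 1)
    (f := fun s ↦ extDNormed a (ξ s) e (ξ' s)) (by
      refine Continuous.continuousOn (Continuous.sub ?_ ?_)
      · exact ((hdac.comp hξc).clm_apply continuous_const).clm_apply hξ'c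
      · exact ((hdac.comp hξc).clm_apply hξ'c).clm_apply continuous_const)
  have hC0 : C 0 = 0 := by
    simp [C, ξ, η, hy₀]
  -- Grönwall with zero initial value and zero inhomogeneity, so the bound is 0.
  have := norm_le_gronwallBound_of_norm_deriv_right_le (f := C) (δ := 0) (K := K) (ε := 0)
    (a := 0) (b := 1) (fun s _ ↦ (hC s).continuousAt.continuousWithinAt)
    (fun s _ ↦ (hC s).hasDerivWithinAt) (by simp [hC0]) (fun s hs ↦ by
      rw [hode s (Set.Ico_subset_Icc_self hs), norm_mul, norm_neg, add_zero]
      gcongr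
      exact hK s (Set.Ico_subset_Icc_self hs)) s s.2
  rw [gronwallBound_ε0_δ0, norm_le_zero_iff] at this
  rw [hxξ, hyη]
  exact this

set_option synthInstance.maxHeartbeats 200000 in
/-- The Frobenius theorem for a one-form which is normalized by `a e = 1`. -/
theorem exists_integral_of_normalized {E : Type u} [NormedAddCommGroup E]
    [NormedSpace ℝ E] [CompleteSpace E] {a : E → E →L[ℝ] ℝ} (ha : ContDiff ℝ ∞ a) {e : E}
    {U : Set E} (hU : IsOpen U) (hae : ∀ x ∈ U, a x e = 1)
    (hint : ∀ x ∈ U, ∀ X Y Z, a x X * extDNormed a x Y Z + a x Y * extDNormed a x Z X +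
      a x Z * extDNormed a x X Y = 0) {p : E} (hp : p ∈ U) :
    ∃ (V : Set E) (α : E → ℝ), IsOpen V ∧ p ∈ V ∧ V ⊆ U ∧ ContDiffOn ℝ ∞ α V ∧
      ∀ x ∈ V, fderiv ℝ α x e ≠ 0 ∧ fderiv ℝ α x e • a x = fderiv ℝ α x := by
  have hda : ContDiff ℝ ∞ (fderiv ℝ a) := ha.fderiv_right (by simp)
  set l := a p with hl
  obtain ⟨Q, x, hQo, h0Q, hxs, hx0, hx, hy⟩ := exists_smooth_family_horizontal_curves
    (.id ℝ (E →L[ℝ] ℝ)) (.id ℝ (E →L[ℝ] E →L[ℝ] ℝ)) ha hda.continuous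
    (fun x ↦ ((ha.differentiable (by simp)) x).hasFDerivAt) p e l
  simp only [ContinuousLinearMap.id_apply] at hx hy
  obtain ⟨r, hr, hrU⟩ := Metric.isOpen_iff.1 hU p hp
  let c₀ : C(Set.Icc (0 : ℝ) 1, E) := ContinuousMap.const _ p
  -- For these parameters the entire curve stays in `U`, where normalization and integrability hold.
  let Q' : Set E := Q ∩ x ⁻¹' Metric.ball c₀ r
  have hQ'o : IsOpen Q' := hxs.continuousOn.isOpen_inter_preimage hQo Metric.isOpen_ball
  have h0Q' : 0 ∈ Q' := ⟨h0Q, by rw [Set.mem_preimage, hx0]; exact Metric.mem_ball_self hr⟩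
  have hxU : ∀ q ∈ Q', ∀ s, x q s ∈ U := fun q hq s ↦
    hrU (lt_of_le_of_lt (ContinuousMap.dist_apply_le_dist s) hq.2)
  let one : Set.Icc (0 : ℝ) 1 := ⟨1, by simp⟩
  let Φ : E → E := fun q ↦ x q one
  have hΦs : ContDiffOn ℝ ∞ Φ Q' :=
    (ContinuousMap.evalCLM ℝ one : C(Set.Icc (0 : ℝ) 1, E) →L[ℝ] E).contDiff.comp_contDiffOn
      (hxs.mono Set.inter_subset_left)
  have hΦd : ∀ q ∈ Q', ∀ δ, fderiv ℝ Φ q δ = fderiv ℝ x q δ one := by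
    intro q hq δ
    have h1 := ((hxs.contDiffAt (hQo.mem_nhds hq.1)).differentiableAt (by simp)).hasFDerivAt
    have h2 := ((ContinuousMap.evalCLM ℝ one : C(Set.Icc (0 : ℝ) 1, E) →L[ℝ] E).hasFDerivAt).comp
      q h1
    exact congr($(h2.fderiv) δ)
  have hker : ∀ q ∈ Q', ∀ δ, l δ = 0 → a (Φ q) (fderiv ℝ Φ q δ) = 0 := by
    intro q hq δ hδ
    rw [hΦd q hq]
    refine extDNormed_eq_zero_along_curve ha hU hae hint (hxU q hq) (y₀ := l δ • e) ?_
      (hx q hq.1) (hy q hq.1 δ) one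
    simp [hδ]
  have hle : l e = 1 := hae p hp
  -- At q = 0 the curve is constant at p, and l = a(p) kills δ - l(δ)e, so the integral correction
  -- disappears and the derivative is the identity.
  have hΦ0 : HasFDerivAt Φ ((ContinuousLinearEquiv.refl ℝ E : E ≃L[ℝ] E) : E →L[ℝ] E) 0 := by
    have h1 := ((hΦs.contDiffAt (hQ'o.mem_nhds h0Q')).differentiableAt (by simp)).hasFDerivAt
    refine h1.congr_fderiv (ContinuousLinearMap.ext fun δ ↦ ?_)
    rw [hΦd 0 h0Q', hy 0 h0Q, hx0]
    simp [one, ← hl, hle]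
  obtain ⟨Ψ, h0Ψ, hΨQ, hΨ, hΨs⟩ :=
    exists_openPartialHomeomorph_contDiffOn_symm hQ'o hΦs h0Q' _ hΦ0
  have hΦ0p : Φ 0 = p := by simp [Φ, hx0]
  have hmem : ∀ z ∈ Ψ.target, z ∈ U := fun z hz ↦ by
    have := hxU _ (hΨQ (Ψ.map_target hz)) one
    rwa [show x _ one = Φ _ from rfl, ← hΨ, Ψ.right_inv hz] at this
  refine ⟨Ψ.target, l ∘ Ψ.symm, Ψ.open_target, ?_, hmem, l.contDiff.comp_contDiffOn hΨs,
    fun z hz ↦ ?_⟩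
  · rw [← hΦ0p, ← hΨ]; exact Ψ.map_source h0Ψ
  set q := Ψ.symm z with hq
  have hqQ : q ∈ Q' := hΨQ (Ψ.map_target hz)
  have hΦq : Φ q = z := by rw [← hΨ]; exact Ψ.right_inv hz
  have hS := ((hΨs.contDiffAt (Ψ.open_target.mem_nhds hz)).differentiableAt
    (by simp)).hasFDerivAt
  have hΦ' := ((hΦs.contDiffAt (hQ'o.mem_nhds hqQ)).differentiableAt (by simp)).hasFDerivAt
  have hid : ∀ w, fderiv ℝ Φ q (fderiv ℝ Ψ.symm z w) = w := by
    have h1 : HasFDerivAt (Φ ∘ Ψ.symm) (ContinuousLinearMap.id ℝ E) z :=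
      (hasFDerivAt_id z).congr_of_eventuallyEq (by
        filter_upwards [Ψ.open_target.mem_nhds hz] with z' hz'
        rw [← hΨ]; exact Ψ.right_inv hz')
    exact fun w ↦ congr($((hΦ'.comp z hS).unique h1) w)
  have hα : ∀ w, fderiv ℝ (l ∘ Ψ.symm) z w = l (fderiv ℝ Ψ.symm z w) := fun w ↦
    congr($((l.hasFDerivAt.comp z hS).fderiv) w)
  -- The preimage of w under DΦ splits into its multiple of e and a part in ker l; `hker` sends the
  -- latter into ker a. Hence a is proportional to dα, and taking w = e identifies the factor.
  have ha' : ∀ w, a z w = a z (fderiv ℝ Φ q e) * fderiv ℝ (l ∘ Ψ.symm) z w := by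
    intro w
    have h1 := hker q hqQ (fderiv ℝ Ψ.symm z w - l (fderiv ℝ Ψ.symm z w) • e) (by simp [hle])
    rw [hΦq, map_sub, map_sub, hid, map_smul, map_smul, smul_eq_mul, ← hα] at h1
    linear_combination h1
  have h1 := ha' e
  rw [hae z (hmem z hz)] at h1
  refine ⟨fun h ↦ by rw [h] at h1; simp at h1, ContinuousLinearMap.ext fun w ↦ ?_⟩
  rw [smul_apply, smul_eq_mul, ha' w]
  linear_combination (-fderiv ℝ (l ∘ Ψ.symm) z w) * h1

/-- The Frobenius theorem: a smooth one-form without zeros such that `a ∧ da = 0` has a local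
integrating factor. -/
theorem exists_integrating_factor {E : Type u} [NormedAddCommGroup E]
    [NormedSpace ℝ E] [CompleteSpace E] [HasContDiffBump E] {a : E → E →L[ℝ] ℝ} {U : Set E}
    (hU : IsOpen U) (ha : ContDiffOn ℝ ∞ a U)
    (hint : ∀ x ∈ U, ∀ X Y Z, a x X * extDNormed a x Y Z + a x Y * extDNormed a x Z X +
      a x Z * extDNormed a x X Y = 0) {p : E} (hp : p ∈ U) (hap : a p ≠ 0) :
    ∃ (V : Set E) (α β : E → ℝ), IsOpen V ∧ p ∈ V ∧ V ⊆ U ∧ ContDiffOn ℝ ∞ α V ∧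
      ContDiffOn ℝ ∞ β V ∧ ∀ x ∈ V, β x ≠ 0 ∧ β x • a x = fderiv ℝ α x := by
  obtain ⟨e, he⟩ : ∃ e, a p e ≠ 0 := by
    obtain ⟨w, hw⟩ := DFunLike.ne_iff.1 hap
    exact ⟨w, by simpa using hw⟩
  have hae : ContDiffOn ℝ ∞ (fun x ↦ a x e) U := ha.clm_apply contDiffOn_const
  let U₁ : Set E := U ∩ (fun x ↦ a x e) ⁻¹' {0}ᶜ
  have hU₁ : IsOpen U₁ := hae.continuousOn.isOpen_inter_preimage hU isOpen_compl_singleton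
  let c : E → ℝ := fun x ↦ (a x e)⁻¹
  have hc : ContDiffOn ℝ ∞ c U₁ := (hae.mono Set.inter_subset_left).inv fun x hx ↦ hx.2
  -- Divide by a(e) to normalize, then extend from a neighbourhood of p, since superposition on the
  -- space of all curves needs a globally smooth form.
  obtain ⟨b, U₂, hb, hU₂, hpU₂, hU₂U₁, hbeq⟩ := exists_contDiff_eqOn_nhds hU₁
    (hc.smul (ha.mono Set.inter_subset_left)) (show p ∈ U₁ from ⟨hp, he⟩)
  have hbd : ∀ x ∈ U₂, ∀ X Y,
      extDNormed b x X Y = fderiv ℝ c x X * a x Y - fderiv ℝ c x Y * a x X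
        + c x * extDNormed a x X Y := by
    intro x hx X Y
    have h1 := ((hc.contDiffAt (hU₁.mem_nhds (hU₂U₁ hx))).differentiableAt (by simp)).hasFDerivAt
    have h2 := ((ha.contDiffAt (hU.mem_nhds (hU₂U₁ hx).1)).differentiableAt
      (by simp)).hasFDerivAt
    have h3 := (h1.smul h2).congr_of_eventuallyEq (f₁ := b) (by
        filter_upwards [hU₂.mem_nhds hx] with y hy using hbeq hy)
    simp only [extDNormed, h3.fderiv]
    simp
    ring
  obtain ⟨V, α, hV, hpV, hVU, hα, h⟩ := exists_integral_of_normalized hb hU₂ (e := e)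
    (fun x hx ↦ by
      rw [hbeq hx]
      exact inv_mul_cancel₀ (hU₂U₁ hx).2)
    (fun x hx X Y Z ↦ by
      simp only [hbd x hx]
      rw [hbeq hx]
      simp only [Pi.smul_apply', smul_apply, smul_eq_mul]
      -- (ca) ∧ d(ca) = c² a ∧ da, since the terms in dc contain a ∧ a.
      linear_combination (c x) ^ 2 * hint x (hU₂U₁ hx).1 X Y Z) hpU₂
  refine ⟨V, α, fun x ↦ fderiv ℝ α x e * c x, hV, hpV, fun x hx ↦ (hU₂U₁ (hVU hx)).1, hα, ?_,
    fun x hx ↦ ⟨mul_ne_zero (h x hx).1 (inv_ne_zero (hU₂U₁ (hVU hx)).2), ?_⟩⟩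
  · exact ((hα.fderiv_of_isOpen hV (by simp)).clm_apply contDiffOn_const).mul
      (hc.mono (hVU.trans hU₂U₁))
  · rw [← (h x hx).2, hbeq (hVU hx), mul_smul]
    rfl

end Frobenius

set_option linter.unusedSectionVars false

/-! ### Components in charts -/

namespace Spacetime

variable {M : Type*} [TopologicalSpace M] [ChartedSpace R4 M] [IsManifold (𝓡 4) ∞ M]

theorem two_le_infty : (2 : WithTop ℕ∞) ≤ ∞ := by
  exact (show ((2 : ℕ∞) : WithTop ℕ∞) ≤ ∞ from WithTop.coe_le_coe.2 le_top)

/-- The inverse of the chart at `x₀`. -/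
def chartInv (x₀ : M) : R4 → M := (extChartAt (𝓡 4) x₀).symm

/-- The domain of the inverse of the chart at `x₀`. -/
def chartDom (x₀ : M) : Set R4 := (extChartAt (𝓡 4) x₀).target

/-- The coordinate frame of the chart at `x₀`. -/
def chartFrame (x₀ : M) (p : R4) : R4 →L[ℝ] Tan (chartInv x₀ p) :=
  mfderiv 𝓘(ℝ, R4) (𝓡 4) (chartInv x₀) p

/-- The components of a one-form in the chart at `x₀`. -/
def formRep (η : ∀ x : M, Tan x →L[ℝ] ℝ) (x₀ : M) (p : R4) : R4 →L[ℝ] ℝ :=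
  (η (chartInv x₀ p)).comp (chartFrame x₀ p)

/-- The components of a vector field in the chart at `x₀`. -/
def vecRep (V : ∀ x : M, Tan x) (x₀ : M) (p : R4) : R4 :=
  (chartFrame x₀ p).inverse (V (chartInv x₀ p))

@[simp] theorem formRep_apply (η : ∀ x : M, Tan x →L[ℝ] ℝ) (x₀ : M) (p X : R4) :
    formRep η x₀ p X = η (chartInv x₀ p) (chartFrame x₀ p X) := rfl

theorem isOpen_chartDom (x₀ : M) : IsOpen (chartDom x₀) := isOpen_extChartAt_target x₀

theorem contMDiffOn_chartInv (x₀ : M) :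
    ContMDiffOn 𝓘(ℝ, R4) (𝓡 4) ∞ (chartInv x₀) (chartDom x₀) :=
  contMDiffOn_extChartAt_symm x₀

theorem contMDiffAt_chartInv {x₀ : M} {p : R4} (hp : p ∈ chartDom x₀) :
    ContMDiffAt 𝓘(ℝ, R4) (𝓡 4) ∞ (chartInv x₀) p :=
  (contMDiffOn_chartInv x₀).contMDiffAt ((isOpen_chartDom x₀).mem_nhds hp)

theorem mem_source_chartInv {x₀ : M} {p : R4} (hp : p ∈ chartDom x₀) :
    chartInv x₀ p ∈ (extChartAt (𝓡 4) x₀).source :=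
  (extChartAt (𝓡 4) x₀).map_target hp

theorem chart_chartInv {x₀ : M} {p : R4} (hp : p ∈ chartDom x₀) :
    extChartAt (𝓡 4) x₀ (chartInv x₀ p) = p :=
  (extChartAt (𝓡 4) x₀).right_inv hp

theorem isInvertible_chartFrame {x₀ : M} {p : R4} (hp : p ∈ chartDom x₀) :
    (chartFrame x₀ p).IsInvertible := by
  have : IsManifold (𝓡 4) 1 M := IsManifold.of_le (n := ∞) (by simp)
  have h := isInvertible_mfderivWithin_extChartAt_symm (I := 𝓡 4) (x := x₀) hp
  rw [ModelWithCorners.range_eq_univ, mfderivWithin_univ] at h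
  exact h

theorem chartFrame_vecRep (V : ∀ x : M, Tan x) {x₀ : M} {p : R4} (hp : p ∈ chartDom x₀) :
    chartFrame x₀ p (vecRep V x₀ p) = V (chartInv x₀ p) :=
  (isInvertible_chartFrame hp).self_apply_inverse _

theorem exists_chartFrame_eq {x₀ : M} {p : R4} (hp : p ∈ chartDom x₀) (X : Tan (chartInv x₀ p)) :
    ∃ Y, chartFrame x₀ p Y = X :=
  ⟨(chartFrame x₀ p).inverse X, (isInvertible_chartFrame hp).self_apply_inverse _⟩

theorem mdifferentiableAt_of_comp_chartInv {f : M → ℝ} {x₀ : M} {p : R4} (hp : p ∈ chartDom x₀)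
    (hf : DifferentiableAt ℝ (f ∘ chartInv x₀) p) :
    MDifferentiableAt (𝓡 4) 𝓘(ℝ, ℝ) f (chartInv x₀ p) := by
  have : IsManifold (𝓡 4) 1 M := IsManifold.of_le (n := ∞) (by simp)
  have hs := mem_source_chartInv hp
  have h1 : MDifferentiableAt (𝓡 4) 𝓘(ℝ, R4) (extChartAt (𝓡 4) x₀) (chartInv x₀ p) :=
    mdifferentiableAt_extChartAt (by simpa using hs)
  have h2 : MDifferentiableAt 𝓘(ℝ, R4) 𝓘(ℝ, ℝ) (f ∘ chartInv x₀)
      (extChartAt (𝓡 4) x₀ (chartInv x₀ p)) := by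
    rw [chart_chartInv hp]
    exact hf.mdifferentiableAt
  refine (h2.comp _ h1).congr_of_eventuallyEq ?_
  filter_upwards [(isOpen_extChartAt_source x₀).mem_nhds hs] with y hy
  exact congrArg f ((extChartAt (𝓡 4) x₀).left_inv hy).symm

theorem differential_chartFrame {f : M → ℝ} {x₀ : M} {p : R4} (hp : p ∈ chartDom x₀)
    (hf : DifferentiableAt ℝ (f ∘ chartInv x₀) p) (X : R4) :
    differential f (chartInv x₀ p) (chartFrame x₀ p X) = fderiv ℝ (f ∘ chartInv x₀) p X := by
  have h1 := mdifferentiableAt_of_comp_chartInv hp hf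
  have h2 := mfderiv_comp p h1 ((contMDiffAt_chartInv hp).mdifferentiableAt (by simp))
  rw [mfderiv_eq_fderiv] at h2
  exact congr($(h2.symm) X)

theorem vecRep_differentiableAt {V : ∀ x : M, Tan x} {x₀ : M} {p : R4} (hp : p ∈ chartDom x₀)
    (hV : MDifferentiableAt (𝓡 4) (𝓡 4).tangent (fun x ↦ (⟨x, V x⟩ : TangentBundle (𝓡 4) M))
      (chartInv x₀ p)) :
    DifferentiableAt ℝ (vecRep V x₀) p := by
  have h := MDifferentiableAt.mpullback_vectorField (n := ∞) hV (contMDiffAt_chartInv hp)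
    (isInvertible_chartFrame hp) two_le_infty
  exact ((contMDiff_snd_tangentBundle_modelSpace R4 𝓘(ℝ, R4)).contMDiffAt.mdifferentiableAt
    one_ne_zero |>.comp p h).differentiableAt

theorem vecRep_contDiffAt {V : ∀ x : M, Tan x} {x₀ : M} {p : R4} (hp : p ∈ chartDom x₀)
    (hV : ContMDiffAt (𝓡 4) (𝓡 4).tangent ∞ (fun x ↦ (⟨x, V x⟩ : TangentBundle (𝓡 4) M))
      (chartInv x₀ p)) :
    ContDiffAt ℝ ∞ (vecRep V x₀) p := by
  have h := ContMDiffAt.mpullback_vectorField_preimage (n := ∞) hV (contMDiffAt_chartInv hp)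
    (isInvertible_chartFrame hp) (by simp)
  exact ((contMDiff_snd_tangentBundle_modelSpace R4 𝓘(ℝ, R4)).contMDiffAt.comp p h).contDiffAt

/-- `vecRep` is the pullback by `chartInv`, and Lie brackets are natural under pullback. -/
theorem vecRep_mlieBracket {V W : ∀ x : M, Tan x} {x₀ : M} {p : R4} (hp : p ∈ chartDom x₀)
    (hV : MDifferentiableAt (𝓡 4) (𝓡 4).tangent (fun x ↦ (⟨x, V x⟩ : TangentBundle (𝓡 4) M))
      (chartInv x₀ p))
    (hW : MDifferentiableAt (𝓡 4) (𝓡 4).tangent (fun x ↦ (⟨x, W x⟩ : TangentBundle (𝓡 4) M))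
      (chartInv x₀ p)) :
    VectorField.mlieBracket (𝓡 4) V W (chartInv x₀ p) = chartFrame x₀ p
      (fderiv ℝ (vecRep W x₀) p (vecRep V x₀ p) - fderiv ℝ (vecRep V x₀) p (vecRep W x₀ p)) := by
  have : IsManifold (𝓡 4) (minSmoothness ℝ 2) M := IsManifold.of_le (n := ∞) (by
    rw [minSmoothness_of_isRCLikeNormedField]; exact two_le_infty)
  have h := VectorField.mpullback_mlieBracket (n := ∞) hV hW (contMDiffAt_chartInv hp) (by
    rw [minSmoothness_of_isRCLikeNormedField]; exact two_le_infty)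
  have e : VectorField.mlieBracket 𝓘(ℝ, R4) (vecRep V x₀) (vecRep W x₀) p =
      VectorField.lieBracket ℝ (vecRep V x₀) (vecRep W x₀) p := by
    have h1 := congrFun (VectorField.mlieBracketWithin_eq_lieBracketWithin (𝕜 := ℝ) (E := R4)
      (V := vecRep V x₀) (W := vecRep W x₀) (s := Set.univ)) p
    exact h1.trans (congrFun VectorField.lieBracketWithin_univ p)
  rw [← chartFrame_vecRep (VectorField.mlieBracket (𝓡 4) V W) hp]
  exact congrArg (chartFrame x₀ p) (h.trans e)

theorem mdifferentiableAt_extend {x : M} (X : Tan x) :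
    MDifferentiableAt (𝓡 4) (𝓡 4).tangent
      (fun y ↦ (⟨y, FiberBundle.extend R4 X y⟩ : TangentBundle (𝓡 4) M)) x :=
  FiberBundle.mdifferentiableAt_extend (𝓡 4) R4 X

theorem vecRep_extend {x₀ : M} {p : R4} (hp : p ∈ chartDom x₀) (X : R4) :
    vecRep (FiberBundle.extend R4 (chartFrame x₀ p X)) x₀ p = X := by
  rw [vecRep, FiberBundle.extend_apply_self]
  exact (isInvertible_chartFrame hp).inverse_apply_self X

/-- The exterior derivative of a one-form in terms of its components in any chart. -/
theorem extD_chartFrame {η : ∀ x : M, Tan x →L[ℝ] ℝ} {x₀ : M} {p : R4} (hp : p ∈ chartDom x₀)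
    (hη : DifferentiableAt ℝ (formRep η x₀) p) (X Y : R4) :
    extD η (chartInv x₀ p) (chartFrame x₀ p X) (chartFrame x₀ p Y) =
      extDNormed (formRep η x₀) p X Y := by
  -- The last term is the derivative of the chosen extension; such terms cancel against the bracket
  -- term of `extD`.
  have key : ∀ Z W : R4, differential
      (fun y ↦ η y (FiberBundle.extend R4 (chartFrame x₀ p W) y)) (chartInv x₀ p)
        (chartFrame x₀ p Z) = fderiv ℝ (formRep η x₀) p Z W +
      formRep η x₀ p (fderiv ℝ (vecRep (FiberBundle.extend R4 (chartFrame x₀ p W)) x₀) p Z) := by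
    intro Z W
    let W' : ∀ y : M, Tan y := FiberBundle.extend R4 (chartFrame x₀ p W)
    have hd := vecRep_differentiableAt hp (mdifferentiableAt_extend (chartFrame x₀ p W))
    have hf : HasFDerivAt ((fun y ↦ η y (W' y)) ∘ chartInv x₀) _ p :=
      (hη.hasFDerivAt.clm_apply hd.hasFDerivAt).congr_of_eventuallyEq (by
        filter_upwards [(isOpen_chartDom x₀).mem_nhds hp] with q hq
        rw [formRep_apply, chartFrame_vecRep _ hq]
        rfl)
    rw [differential_chartFrame hp hf.differentiableAt, hf.fderiv]
    simp [vecRep_extend hp, add_comm]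
  simp only [extD]
  rw [key, key, vecRep_mlieBracket hp (mdifferentiableAt_extend _) (mdifferentiableAt_extend _),
    ← formRep_apply, vecRep_extend hp, vecRep_extend hp, map_sub, extDNormed]
  ring

theorem sgn_mul_self (i : Fin 4) : sgn i * sgn i = 1 := by
  unfold sgn; split <;> norm_num

/-! ### The metric and the covariant derivative in charts -/

namespace LorentzMetric

variable (g : LorentzMetric M)

theorem inner_sharp {x : M} (α : Tan x →ₗ[ℝ] ℝ) (Z : Tan x) :
    g.inner x (g.sharp α) Z = α Z := by
  have h : (g.inner x (g.sharp α)).toLinearMap = α := by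
    refine (g.frame x).ext fun j ↦ ?_
    simp only [sharp, ContinuousLinearMap.coe_coe, map_sum, map_smul, sum_apply,
      smul_apply, smul_eq_mul]
    rw [Finset.sum_eq_single j]
    · rw [g.inner_frame, if_pos rfl]
      linear_combination (α (g.frame x j)) * sgn_mul_self j
    · intro i _ hij
      rw [g.inner_frame, if_neg hij, mul_zero]
    · simp
  exact congr($h Z)

theorem eq_zero_of_inner {x : M} {v : Tan x} (h : ∀ w, g.inner x v w = 0) : v = 0 := by
  have h1 : ∀ j, (g.frame x).repr v j = 0 := by
    intro j
    have h2 := h (g.frame x j)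
    rw [← (g.frame x).sum_repr v] at h2
    simp only [map_sum, map_smul, sum_apply, smul_apply, smul_eq_mul] at h2
    rw [Finset.sum_eq_single j] at h2
    · rw [g.inner_frame, if_pos rfl] at h2
      have := sgn_mul_self j
      linear_combination sgn j * h2 - (g.frame x).repr v j * this
    · intro i _ hij
      rw [g.inner_frame, if_neg hij, mul_zero]
    · simp
  rw [← (g.frame x).sum_repr v]
  simp [h1]

theorem frame_repr (x : M) (v : Tan x) (j : Fin 4) :
    (g.frame x).repr v j = sgn j * g.inner x v (g.frame x j) := by
  conv_rhs => rw [← (g.frame x).sum_repr v]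
  simp only [map_sum, map_smul, sum_apply, smul_apply, smul_eq_mul]
  rw [Finset.sum_eq_single j]
  · rw [g.inner_frame, if_pos rfl]
    linear_combination (-(g.frame x).repr v j) * sgn_mul_self j
  · intro i _ hij
    rw [g.inner_frame, if_neg hij, mul_zero]
  · simp

/-- The components of the metric in the chart at `x₀`. -/
def metricRep (x₀ : M) (p : R4) : R4 →L[ℝ] R4 →L[ℝ] ℝ :=
  ((ContinuousLinearMap.precomp ℝ (chartFrame x₀ p)).comp (g.inner (chartInv x₀ p))).comp
    (chartFrame x₀ p)

@[simp] theorem metricRep_apply (x₀ : M) (p X Y : R4) : g.metricRep x₀ p X Y =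
    g.inner (chartInv x₀ p) (chartFrame x₀ p X) (chartFrame x₀ p Y) := rfl

theorem metricRep_symm (x₀ : M) (p X Y : R4) : g.metricRep x₀ p X Y = g.metricRep x₀ p Y X :=
  g.symm _ _ _

end LorentzMetric

theorem contMDiffAt_chartFrame {x₀ : M} {p : R4} (hp : p ∈ chartDom x₀) (X : R4) :
    ContMDiffAt 𝓘(ℝ, R4) (𝓡 4).tangent ∞
      (fun q ↦ (⟨chartInv x₀ q, chartFrame x₀ q X⟩ : TangentBundle (𝓡 4) M)) p := by
  have h1 : ContMDiffAt 𝓘(ℝ, R4) 𝓘(ℝ, R4).tangent ∞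
      (fun q ↦ (⟨q, X⟩ : TangentBundle 𝓘(ℝ, R4) R4)) p := by
    exact contMDiffAt_vectorSpace_iff_contDiffAt.2
      (contDiffAt_const (c := X))
  have h2 := ContMDiffAt.mfderiv_const (m := ∞) (contMDiffAt_chartInv hp) (by simp)
  exact ContMDiffAt.clm_apply_of_inCoordinates (F₁ := R4) (F₂ := R4)
    (E₁ := TangentSpace 𝓘(ℝ, R4)) (E₂ := (TangentSpace (𝓡 4) : M → Type _)) (b₁ := id)
    (b₂ := chartInv x₀) (ϕ := fun q ↦ mfderiv 𝓘(ℝ, R4) (𝓡 4) (chartInv x₀) q)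
    (v := fun q ↦ (X : TangentSpace 𝓘(ℝ, R4) q)) h2 h1 (contMDiffAt_chartInv hp)

namespace LorentzMetric

variable (g : LorentzMetric M)

/-- In finite dimension it suffices to evaluate on constant vectors, whose images under `chartFrame`
are smooth sections of the tangent bundle. -/
theorem contDiffAt_metricRep {x₀ : M} {p : R4} (hp : p ∈ chartDom x₀) :
    ContDiffAt ℝ ∞ (g.metricRep x₀) p := by
  have h : ContDiffOn ℝ ∞ (g.metricRep x₀) (chartDom x₀) := by
    rw [contDiffOn_clm_apply]
    intro X
    rw [contDiffOn_clm_apply]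
    intro Y q hq
    have h1 := ContMDiffAt.comp q (g.contMDiff (chartInv x₀ q)) (contMDiffAt_chartInv hq)
    have h2 : ContMDiffAt 𝓘(ℝ, R4) ((𝓡 4).prod 𝓘(ℝ, ℝ)) ∞
        (fun m ↦ TotalSpace.mk' ℝ (E := Bundle.Trivial M ℝ) (chartInv x₀ m)
          (g.inner (chartInv x₀ m) (chartFrame x₀ m X) (chartFrame x₀ m Y))) q := by
      apply ContMDiffAt.clm_bundle_apply₂ (F₁ := R4) (F₂ := R4)
      · exact h1
      · exact contMDiffAt_chartFrame hq X
      · exact contMDiffAt_chartFrame hq Y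
    rw [contMDiffAt_totalSpace] at h2
    exact h2.2.contDiffAt.contDiffWithinAt
  exact h.contDiffAt ((isOpen_chartDom x₀).mem_nhds hp)

theorem isInvertible_metricRep {x₀ : M} {p : R4} (hp : p ∈ chartDom x₀) :
    (g.metricRep x₀ p).IsInvertible := by
  have hinj : Function.Injective (g.metricRep x₀ p).toLinearMap := by
    rw [← LinearMap.ker_eq_bot, LinearMap.ker_eq_bot']
    intro X hX
    have h1 : chartFrame x₀ p X = 0 := by
      refine g.eq_zero_of_inner fun w ↦ ?_
      obtain ⟨Y, rfl⟩ := exists_chartFrame_eq hp w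
      exact congr($hX Y)
    exact (isInvertible_chartFrame hp).injective (by rw [h1, map_zero])
  have hdim : Module.finrank ℝ R4 = Module.finrank ℝ (R4 →L[ℝ] ℝ) := by
    rw [← (LinearMap.toContinuousLinearMap (𝕜 := ℝ) (E := R4) (F' := ℝ)).finrank_eq]
    exact (Subspace.dual_finrank_eq (K := ℝ) (V := R4)).symm
  exact ⟨(LinearEquiv.ofInjectiveOfFinrankEq _ hinj hdim).toContinuousLinearEquiv, by
    ext; rfl⟩

theorem differential_inner {V W : ∀ x : M, Tan x} {x₀ : M} {p : R4} (hp : p ∈ chartDom x₀)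
    (hV : DifferentiableAt ℝ (vecRep V x₀) p) (hW : DifferentiableAt ℝ (vecRep W x₀) p) (Z : R4) :
    differential (fun y ↦ g.inner y (V y) (W y)) (chartInv x₀ p) (chartFrame x₀ p Z) =
      fderiv ℝ (g.metricRep x₀) p Z (vecRep V x₀ p) (vecRep W x₀ p) +
      g.metricRep x₀ p (fderiv ℝ (vecRep V x₀) p Z) (vecRep W x₀ p) +
      g.metricRep x₀ p (vecRep V x₀ p) (fderiv ℝ (vecRep W x₀) p Z) := by
  have hG := ((g.contDiffAt_metricRep hp).differentiableAt (by simp)).hasFDerivAt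
  have hf : HasFDerivAt ((fun y ↦ g.inner y (V y) (W y)) ∘ chartInv x₀) _ p :=
    ((hG.clm_apply hV.hasFDerivAt).clm_apply hW.hasFDerivAt).congr_of_eventuallyEq (by
      filter_upwards [(isOpen_chartDom x₀).mem_nhds hp] with q hq
      rw [metricRep_apply, chartFrame_vecRep _ hq, chartFrame_vecRep _ hq]
      rfl)
  rw [differential_chartFrame hp hf.differentiableAt, hf.fderiv]
  simp only [add_apply, ContinuousLinearMap.comp_apply, ContinuousLinearMap.flip_apply]
  ring

theorem fderiv_metricRep_symm {x₀ : M} {p : R4} (hp : p ∈ chartDom x₀) (X Y Z : R4) :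
    fderiv ℝ (g.metricRep x₀) p Z X Y = fderiv ℝ (g.metricRep x₀) p Z Y X := by
  have hG := ((g.contDiffAt_metricRep hp).differentiableAt (by simp)).hasFDerivAt
  have h : ∀ X Y, HasFDerivAt (fun q ↦ g.metricRep x₀ q X Y) _ p := fun X Y ↦
    (hG.clm_apply (hasFDerivAt_const X p)).clm_apply (hasFDerivAt_const Y p)
  have h1 := h X Y
  simp only [g.metricRep_symm x₀ _ X Y] at h1
  simpa using congr($(h1.unique (h Y X)) Z)

/-- The components of the covariant derivative of `V`, as a bilinear form, in the chart at `x₀`. -/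
def covRep (V : ∀ x : M, Tan x) (x₀ : M) (p : R4) : R4 →L[ℝ] R4 →L[ℝ] ℝ :=
  (g.metricRep x₀ p).comp (fderiv ℝ (vecRep V x₀) p) +
    (1 / 2 : ℝ) • ((fderiv ℝ (g.metricRep x₀) p).flip (vecRep V x₀ p) +
      fderiv ℝ (g.metricRep x₀) p (vecRep V x₀ p) -
      ((fderiv ℝ (g.metricRep x₀) p).flip (vecRep V x₀ p)).flip)

theorem covRep_apply (V : ∀ x : M, Tan x) (x₀ : M) (p X Z : R4) : g.covRep V x₀ p X Z =
    g.metricRep x₀ p (fderiv ℝ (vecRep V x₀) p X) Z +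
    (1 / 2) * (fderiv ℝ (g.metricRep x₀) p X (vecRep V x₀ p) Z +
      fderiv ℝ (g.metricRep x₀) p (vecRep V x₀ p) X Z -
      fderiv ℝ (g.metricRep x₀) p Z (vecRep V x₀ p) X) := rfl

/-- In the Koszul formula the derivatives of the extensions of X and Z cancel between the
differentials and the brackets. What remains is linear in Z, which is what allows `inner_sharp` to
undo `sharp`. -/
theorem inner_covDeriv {V : ∀ x : M, Tan x} {x₀ : M} {p : R4} (hp : p ∈ chartDom x₀)
    (hV : MDifferentiableAt (𝓡 4) (𝓡 4).tangent (fun x ↦ (⟨x, V x⟩ : TangentBundle (𝓡 4) M))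
      (chartInv x₀ p)) (X Z : R4) :
    g.inner (chartInv x₀ p) (g.covDeriv V (chartInv x₀ p) (chartFrame x₀ p X))
      (chartFrame x₀ p Z) = g.covRep V x₀ p X Z := by
  have hVd := vecRep_differentiableAt hp hV
  have hTV := chartFrame_vecRep V hp
  let T' : Tan (chartInv x₀ p) →L[ℝ] R4 := (chartFrame x₀ p).inverse
  have hT' : ∀ X, T' (chartFrame x₀ p X) = X := fun X ↦
    (isInvertible_chartFrame hp).inverse_apply_self X
  have key : g.covDeriv V (chartInv x₀ p) (chartFrame x₀ p X) =
      g.sharp ((g.covRep V x₀ p X).comp T').toLinearMap := by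
    unfold covDeriv
    congr 1
    funext w
    obtain ⟨Z, rfl⟩ := exists_chartFrame_eq hp w
    have hX := mdifferentiableAt_extend (chartFrame x₀ p X)
    have hZ := mdifferentiableAt_extend (chartFrame x₀ p Z)
    have hXd := vecRep_differentiableAt hp hX
    have hZd := vecRep_differentiableAt hp hZ
    have h1 := g.differential_inner hp hVd hZd X
    have h2 := g.differential_inner hp hXd hZd (vecRep V x₀ p)
    have h3 := g.differential_inner hp hXd hVd Z
    rw [hTV] at h2
    simp only [ContinuousLinearMap.coe_coe, ContinuousLinearMap.comp_apply]
    rw [h1, h2, h3, vecRep_mlieBracket hp hX hV, vecRep_mlieBracket hp hV hZ,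
      vecRep_mlieBracket hp hX hZ, vecRep_extend hp, vecRep_extend hp, hT', ← hTV]
    simp only [← metricRep_apply]
    rw [covRep_apply, g.fderiv_metricRep_symm hp X (vecRep V x₀ p) Z]
    simp only [map_sub, sub_apply]
    rw [g.metricRep_symm x₀ p (vecRep V x₀ p), g.metricRep_symm x₀ p X (fderiv ℝ _ _ _),
      g.metricRep_symm x₀ p X (fderiv ℝ _ _ _)]
    ring
  rw [key, inner_sharp]
  simp [hT']

end LorentzMetric

theorem exists_chartInv_eq (x : M) : ∃ (x₀ : M) (p : R4), p ∈ chartDom x₀ ∧ chartInv x₀ p = x :=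
  ⟨x, extChartAt (𝓡 4) x x, mem_extChartAt_target x, extChartAt_to_inv x⟩

theorem contMDiffAt_of_comp_chartInv {f : M → ℝ} {x₀ : M} {p : R4} (hp : p ∈ chartDom x₀)
    (hf : ContDiffAt ℝ ∞ (f ∘ chartInv x₀) p) :
    ContMDiffAt (𝓡 4) 𝓘(ℝ, ℝ) ∞ f (chartInv x₀ p) := by
  have hs := mem_source_chartInv hp
  have h1 : ContMDiffAt (𝓡 4) 𝓘(ℝ, R4) ∞ (extChartAt (𝓡 4) x₀) (chartInv x₀ p) :=
    contMDiffAt_extChartAt' (by simpa using hs)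
  have h2 : ContMDiffAt 𝓘(ℝ, R4) 𝓘(ℝ, ℝ) ∞ (f ∘ chartInv x₀)
      (extChartAt (𝓡 4) x₀ (chartInv x₀ p)) := by
    rw [chart_chartInv hp]
    exact hf.contMDiffAt
  refine (h2.comp _ h1).congr_of_eventuallyEq ?_
  filter_upwards [(isOpen_extChartAt_source x₀).mem_nhds hs] with y hy
  exact congrArg f ((extChartAt (𝓡 4) x₀).left_inv hy).symm

theorem contDiffAt_comp_chartInv {f : M → ℝ} {x₀ : M} {p : R4} (hp : p ∈ chartDom x₀)
    (hf : ContMDiffAt (𝓡 4) 𝓘(ℝ, ℝ) ∞ f (chartInv x₀ p)) :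
    ContDiffAt ℝ ∞ (f ∘ chartInv x₀) p :=
  (hf.comp p (contMDiffAt_chartInv hp)).contDiffAt

theorem continuousAt_chartInv {x₀ : M} {p : R4} (hp : p ∈ chartDom x₀) :
    ContinuousAt (chartInv x₀) p := (contMDiffAt_chartInv hp).continuousAt

/-! ### Smooth one-forms and the calculus of the exterior derivative -/

/-- A one-form is smooth at `x` if its components are smooth in every chart. -/
def FormSmoothAt (η : ∀ x : M, Tan x →L[ℝ] ℝ) (x : M) : Prop :=
  ∀ (x₀ : M) (p : R4), p ∈ chartDom x₀ → chartInv x₀ p = x → ContDiffAt ℝ ∞ (formRep η x₀) p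

theorem FormSmoothAt.differentiableAt {η : ∀ x : M, Tan x →L[ℝ] ℝ} {x₀ : M} {p : R4}
    (h : FormSmoothAt η (chartInv x₀ p)) (hp : p ∈ chartDom x₀) :
    DifferentiableAt ℝ (formRep η x₀) p :=
  (h x₀ p hp rfl).differentiableAt (by simp)

theorem FormSmoothAt.congr {η ζ : ∀ x : M, Tan x →L[ℝ] ℝ} {x : M} (h : FormSmoothAt η x)
    (hηζ : ∀ᶠ y in 𝓝 x, ζ y = η y) : FormSmoothAt ζ x := by
  rintro x₀ p hp rfl
  refine (h x₀ p hp rfl).congr_of_eventuallyEq ?_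
  filter_upwards [(continuousAt_chartInv hp).eventually hηζ] with q hq
  rw [formRep, formRep, hq]

theorem FormSmoothAt.smul {η : ∀ x : M, Tan x →L[ℝ] ℝ} {x : M} (h : FormSmoothAt η x)
    {f : M → ℝ} (hf : ContMDiffAt (𝓡 4) 𝓘(ℝ, ℝ) ∞ f x) :
    FormSmoothAt (fun y ↦ f y • η y) x := by
  rintro x₀ p hp rfl
  exact (contDiffAt_comp_chartInv hp hf).smul (h x₀ p hp rfl)

theorem FormSmoothAt.sub {η ζ : ∀ x : M, Tan x →L[ℝ] ℝ} {x : M} (h : FormSmoothAt η x)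
    (h' : FormSmoothAt ζ x) : FormSmoothAt (fun y ↦ η y - ζ y) x := by
  rintro x₀ p hp rfl
  exact (h x₀ p hp rfl).sub (h' x₀ p hp rfl)

theorem extD_congr {η ζ : ∀ x : M, Tan x →L[ℝ] ℝ} {x : M} (hη : FormSmoothAt η x)
    (hηζ : ∀ᶠ y in 𝓝 x, ζ y = η y) (X Y : Tan x) : extD ζ x X Y = extD η x X Y := by
  have hζ := hη.congr hηζ
  obtain ⟨x₀, p, hp, rfl⟩ := exists_chartInv_eq x
  obtain ⟨X, rfl⟩ := exists_chartFrame_eq hp X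
  obtain ⟨Y, rfl⟩ := exists_chartFrame_eq hp Y
  rw [extD_chartFrame hp (hη.differentiableAt hp), extD_chartFrame hp (hζ.differentiableAt hp)]
  have : formRep ζ x₀ =ᶠ[𝓝 p] formRep η x₀ := by
    filter_upwards [(continuousAt_chartInv hp).eventually hηζ] with q hq
    rw [formRep, formRep, hq]
  rw [extDNormed, extDNormed, this.fderiv_eq]

theorem extD_smul {η : ∀ x : M, Tan x →L[ℝ] ℝ} {x : M} (hη : FormSmoothAt η x)
    {f : M → ℝ} (hf : ContMDiffAt (𝓡 4) 𝓘(ℝ, ℝ) ∞ f x) (X Y : Tan x) :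
    extD (fun y ↦ f y • η y) x X Y =
      differential f x X * η x Y - differential f x Y * η x X + f x * extD η x X Y := by
  have h := hη.smul hf
  obtain ⟨x₀, p, hp, rfl⟩ := exists_chartInv_eq x
  obtain ⟨X, rfl⟩ := exists_chartFrame_eq hp X
  obtain ⟨Y, rfl⟩ := exists_chartFrame_eq hp Y
  have hf' := (contDiffAt_comp_chartInv hp hf).differentiableAt (by simp)
  rw [extD_chartFrame hp (hη.differentiableAt hp), extD_chartFrame hp (h.differentiableAt hp),
    differential_chartFrame hp hf', differential_chartFrame hp hf']
  have h1 : HasFDerivAt (formRep (fun y ↦ f y • η y) x₀) _ p :=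
    hf'.hasFDerivAt.smul (hη.differentiableAt hp).hasFDerivAt
  rw [extDNormed, h1.fderiv, extDNormed]
  simp
  ring

theorem extD_sub {η ζ : ∀ x : M, Tan x →L[ℝ] ℝ} {x : M} (hη : FormSmoothAt η x)
    (hζ : FormSmoothAt ζ x) (X Y : Tan x) :
    extD (fun y ↦ η y - ζ y) x X Y = extD η x X Y - extD ζ x X Y := by
  have h := hη.sub hζ
  obtain ⟨x₀, p, hp, rfl⟩ := exists_chartInv_eq x
  obtain ⟨X, rfl⟩ := exists_chartFrame_eq hp X
  obtain ⟨Y, rfl⟩ := exists_chartFrame_eq hp Y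
  rw [extD_chartFrame hp (hη.differentiableAt hp), extD_chartFrame hp (h.differentiableAt hp),
    extD_chartFrame hp (hζ.differentiableAt hp)]
  have h1 : HasFDerivAt (formRep (fun y ↦ η y - ζ y) x₀) _ p :=
    (hη.differentiableAt hp).hasFDerivAt.sub (hζ.differentiableAt hp).hasFDerivAt
  rw [extDNormed, h1.fderiv, extDNormed, extDNormed]
  simp
  ring

/-- `extD` is defined through extensions of vectors, so tensoriality has to be recovered from the
chart formula before multilinear algebra can be applied to it. -/
theorem extD_bilinear {η : ∀ x : M, Tan x →L[ℝ] ℝ} {x : M} (hη : FormSmoothAt η x) :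
    ∃ B : Tan x →ₗ[ℝ] Tan x →ₗ[ℝ] ℝ, (∀ X Y, extD η x X Y = B X Y) ∧ ∀ X Y, B X Y = -B Y X := by
  obtain ⟨x₀, p, hp, rfl⟩ := exists_chartInv_eq x
  let T' : Tan (chartInv x₀ p) →L[ℝ] R4 := (chartFrame x₀ p).inverse
  have hT' : ∀ X, T' (chartFrame x₀ p X) = X := fun X ↦
    (isInvertible_chartFrame hp).inverse_apply_self X
  let B : R4 →ₗ[ℝ] R4 →ₗ[ℝ] ℝ := LinearMap.mk₂ ℝ (extDNormed (formRep η x₀) p)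
    (fun X Y Z ↦ by simp only [extDNormed, map_add, add_apply]; ring)
    (fun c X Y ↦ by simp only [extDNormed, map_smul, smul_apply, smul_eq_mul]; ring)
    (fun X Y Z ↦ by simp only [extDNormed, map_add, add_apply]; ring)
    (fun c X Y ↦ by simp only [extDNormed, map_smul, smul_apply, smul_eq_mul]; ring)
  have hB : ∀ X Y, B.compl₁₂ T'.toLinearMap T'.toLinearMap X Y =
    extDNormed (formRep η x₀) p (T' X) (T' Y) := fun X Y ↦ rfl
  refine ⟨B.compl₁₂ T'.toLinearMap T'.toLinearMap, fun X Y ↦ ?_, fun X Y ↦ ?_⟩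
  · obtain ⟨X, rfl⟩ := exists_chartFrame_eq hp X
    obtain ⟨Y, rfl⟩ := exists_chartFrame_eq hp Y
    rw [extD_chartFrame hp (hη.differentiableAt hp), hB, hT', hT']
  · rw [hB, hB, extDNormed, extDNormed, neg_sub]

theorem formSmoothAt_differential {α : M → ℝ} {x : M}
    (hα : ∀ᶠ y in 𝓝 x, ContMDiffAt (𝓡 4) 𝓘(ℝ, ℝ) ∞ α y) : FormSmoothAt (differential α) x := by
  rintro x₀ p hp rfl
  have h1 : formRep (differential α) x₀ =ᶠ[𝓝 p] fderiv ℝ (α ∘ chartInv x₀) := by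
    filter_upwards [(continuousAt_chartInv hp).eventually hα,
      (isOpen_chartDom x₀).mem_nhds hp] with q hq hqd
    ext X
    exact differential_chartFrame hqd
      ((contDiffAt_comp_chartInv hqd hq).differentiableAt (by simp)) X
  exact ((contDiffAt_comp_chartInv hp hα.self_of_nhds).fderiv_right (by simp)).congr_of_eventuallyEq
    h1

theorem extD_differential {α : M → ℝ} {x : M}
    (hα : ∀ᶠ y in 𝓝 x, ContMDiffAt (𝓡 4) 𝓘(ℝ, ℝ) ∞ α y) (X Y : Tan x) :
    extD (differential α) x X Y = 0 := by
  have h := formSmoothAt_differential hα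
  obtain ⟨x₀, p, hp, rfl⟩ := exists_chartInv_eq x
  obtain ⟨X, rfl⟩ := exists_chartFrame_eq hp X
  obtain ⟨Y, rfl⟩ := exists_chartFrame_eq hp Y
  have h1 : formRep (differential α) x₀ =ᶠ[𝓝 p] fderiv ℝ (α ∘ chartInv x₀) := by
    filter_upwards [(continuousAt_chartInv hp).eventually hα,
      (isOpen_chartDom x₀).mem_nhds hp] with q hq hqd
    ext X
    exact differential_chartFrame hqd
      ((contDiffAt_comp_chartInv hqd hq).differentiableAt (by simp)) X
  have h2 := (contDiffAt_comp_chartInv hp hα.self_of_nhds).isSymmSndFDerivAt (by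
    rw [minSmoothness_of_isRCLikeNormedField]; exact two_le_infty)
  rw [extD_chartFrame hp (h.differentiableAt hp), extDNormed, h1.fderiv_eq, h2 X Y, sub_self]

/-! ### Acceleration and expansion of a unit time-like field -/

namespace LorentzMetric

variable (g : LorentzMetric M) {u : ∀ x : M, Tan x}

theorem contDiffAt_vecRep (hu : g.IsUnitTimelike u) {x₀ : M} {p : R4} (hp : p ∈ chartDom x₀) :
    ContDiffAt ℝ ∞ (vecRep u x₀) p := vecRep_contDiffAt hp hu.1.contMDiffAt

theorem mdifferentiableAt_of_isUnitTimelike (hu : g.IsUnitTimelike u) (x : M) :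
    MDifferentiableAt (𝓡 4) (𝓡 4).tangent (fun x ↦ (⟨x, u x⟩ : TangentBundle (𝓡 4) M)) x :=
  hu.1.mdifferentiableAt (by simp)

theorem formRep_flat (V : ∀ x : M, Tan x) {x₀ : M} {p : R4} (hp : p ∈ chartDom x₀) :
    formRep (g.flat V) x₀ p = g.metricRep x₀ p (vecRep V x₀ p) := by
  ext X
  rw [formRep_apply, metricRep_apply, chartFrame_vecRep V hp]
  rfl

theorem formSmoothAt_flat (hu : g.IsUnitTimelike u) (x : M) : FormSmoothAt (g.flat u) x := by
  rintro x₀ p hp rfl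
  refine ((g.contDiffAt_metricRep hp).clm_apply (g.contDiffAt_vecRep hu hp)).congr_of_eventuallyEq
    ?_
  filter_upwards [(isOpen_chartDom x₀).mem_nhds hp] with q hq using g.formRep_flat u hq

set_option synthInstance.maxHeartbeats 100000 in
theorem contDiffAt_covRep (hu : g.IsUnitTimelike u) {x₀ : M} {p : R4} (hp : p ∈ chartDom x₀) :
    ContDiffAt ℝ ∞ (g.covRep u x₀) p := by
  have h : ContDiffOn ℝ ∞ (g.covRep u x₀) (chartDom x₀) := by
    rw [contDiffOn_clm_apply]
    intro X
    rw [contDiffOn_clm_apply]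
    intro Z q hq
    have hG := g.contDiffAt_metricRep hq
    have hV := g.contDiffAt_vecRep hu hq
    have hG' := hG.fderiv_right (m := ∞) (by simp)
    have hV' : ContDiffAt ℝ ∞ (fderiv ℝ (vecRep u x₀)) q := hV.fderiv_right (by simp)
    have hX : ContDiffAt ℝ ∞ (fun _ : R4 ↦ X) q := contDiffAt_const
    have hZ : ContDiffAt ℝ ∞ (fun _ : R4 ↦ Z) q := contDiffAt_const
    have key : (fun q ↦ g.covRep u x₀ q X Z) = fun q ↦
        g.metricRep x₀ q (fderiv ℝ (vecRep u x₀) q X) Z +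
        (1 / 2) * (fderiv ℝ (g.metricRep x₀) q X (vecRep u x₀ q) Z +
          fderiv ℝ (g.metricRep x₀) q (vecRep u x₀ q) X Z -
          fderiv ℝ (g.metricRep x₀) q Z (vecRep u x₀ q) X) := rfl
    rw [key]
    exact (((hG.clm_apply (hV'.clm_apply hX)).clm_apply hZ).add
      (contDiffAt_const.mul (((((hG'.clm_apply hX).clm_apply hV).clm_apply hZ).add
        (((hG'.clm_apply hV).clm_apply hX).clm_apply hZ)).sub
        (((hG'.clm_apply hZ).clm_apply hV).clm_apply hX)))).contDiffWithinAt
  exact h.contDiffAt ((isOpen_chartDom x₀).mem_nhds hp)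

theorem formRep_accel (hu : g.IsUnitTimelike u) {x₀ : M} {p : R4} (hp : p ∈ chartDom x₀) :
    formRep (g.flat (g.accel u)) x₀ p = g.covRep u x₀ p (vecRep u x₀ p) := by
  ext Z
  rw [← g.inner_covDeriv hp (g.mdifferentiableAt_of_isUnitTimelike hu _), chartFrame_vecRep u hp]
  rfl

theorem formSmoothAt_accel (hu : g.IsUnitTimelike u) (x : M) :
    FormSmoothAt (g.flat (g.accel u)) x := by
  rintro x₀ p hp rfl
  refine ((g.contDiffAt_covRep hu hp).clm_apply (g.contDiffAt_vecRep hu hp)).congr_of_eventuallyEq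
    ?_
  filter_upwards [(isOpen_chartDom x₀).mem_nhds hp] with q hq using g.formRep_accel hu hq

/-- The acceleration is `i(u) du`. -/
theorem flat_accel_apply (hu : g.IsUnitTimelike u) (x : M) (Z : Tan x) :
    g.flat (g.accel u) x Z = extD (g.flat u) x (u x) Z := by
  obtain ⟨x₀, p, hp, rfl⟩ := exists_chartInv_eq x
  obtain ⟨Z, rfl⟩ := exists_chartFrame_eq hp Z
  have hG := ((g.contDiffAt_metricRep hp).differentiableAt (by simp)).hasFDerivAt
  have hV := ((g.contDiffAt_vecRep hu hp).differentiableAt (by simp)).hasFDerivAt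
  have h1 : HasFDerivAt (formRep (g.flat u) x₀) _ p :=
    (hG.clm_apply hV).congr_of_eventuallyEq (by
      filter_upwards [(isOpen_chartDom x₀).mem_nhds hp] with q hq using g.formRep_flat u hq)
  -- The two sides differ by half the derivative of u², which vanishes since u² = -1.
  have h2 : HasFDerivAt (fun q ↦ g.metricRep x₀ q (vecRep u x₀ q) (vecRep u x₀ q)) _ p :=
    (hG.clm_apply hV).clm_apply hV
  have h3 : HasFDerivAt (fun q ↦ g.metricRep x₀ q (vecRep u x₀ q) (vecRep u x₀ q))
      (0 : R4 →L[ℝ] ℝ) p :=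
    (hasFDerivAt_const (-1 : ℝ) p).congr_of_eventuallyEq (by
      filter_upwards [(isOpen_chartDom x₀).mem_nhds hp] with q hq
      rw [metricRep_apply, chartFrame_vecRep u hq]
      exact hu.2 _)
  have h4 := congr($(h2.unique h3) Z)
  rw [← formRep_apply, g.formRep_accel hu hp, ← chartFrame_vecRep u hp,
    extD_chartFrame hp ((g.formSmoothAt_flat hu _).differentiableAt hp), extDNormed, h1.fderiv,
    covRep_apply]
  simp only [add_apply, ContinuousLinearMap.comp_apply, ContinuousLinearMap.flip_apply,
    zero_apply] at h4 ⊢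
  rw [g.metricRep_symm x₀ p (vecRep u x₀ p)] at h4
  linear_combination (1 / 2 : ℝ) * h4

/-- The frames in `div` are chosen point by point with no continuity. The sum equals the trace of
the inverse metric composed with `covRep`, which is independent of the frame and smooth. -/
theorem contMDiff_expansion (hu : g.IsUnitTimelike u) :
    ContMDiff (𝓡 4) 𝓘(ℝ, ℝ) ∞ (g.expansion u) := by
  intro x
  obtain ⟨x₀, p, hp, rfl⟩ := exists_chartInv_eq x
  refine contMDiffAt_of_comp_chartInv hp ?_
  let tr : (R4 →L[ℝ] R4) →L[ℝ] ℝ := LinearMap.toContinuousLinearMap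
    ((LinearMap.trace ℝ R4).comp
      (LinearMap.toContinuousLinearMap (𝕜 := ℝ) (E := R4) (F' := R4)).symm.toLinearMap)
  have htr : ∀ N : R4 →L[ℝ] R4, tr N = LinearMap.trace ℝ R4 N.toLinearMap := fun N ↦ rfl
  have h : g.expansion u ∘ chartInv x₀ =ᶠ[𝓝 p] fun q ↦
      tr ((g.metricRep x₀ q).inverse.comp (g.covRep u x₀ q)) := by
    filter_upwards [(isOpen_chartDom x₀).mem_nhds hp] with q hq
    let T := chartFrame x₀ q
    obtain ⟨e, he⟩ := isInvertible_chartFrame hq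
    let b : Module.Basis (Fin 4) ℝ R4 := (g.frame (chartInv x₀ q)).map e.symm.toLinearEquiv
    have hb : ∀ i, chartFrame x₀ q (b i) = g.frame (chartInv x₀ q) i := by
      intro i
      rw [← he]
      simp [b]
    rw [htr, LinearMap.trace_eq_matrix_trace ℝ b, Matrix.trace, Function.comp_apply, expansion, div]
    refine Finset.sum_congr rfl fun i _ ↦ ?_
    rw [Matrix.diag_apply, LinearMap.toMatrix_apply]
    have h1 : ∀ w, b.repr w i = (g.frame (chartInv x₀ q)).repr (chartFrame x₀ q w) i := by
      intro w
      rw [← he]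
      simp [b]
    rw [h1, frame_repr, ← hb, ← metricRep_apply, ContinuousLinearMap.coe_coe,
      ContinuousLinearMap.comp_apply, (g.isInvertible_metricRep hq).self_apply_inverse,
      g.inner_covDeriv hq (g.mdifferentiableAt_of_isUnitTimelike hu _)]
  refine ContDiffAt.congr_of_eventuallyEq ?_ h
  have h1 := ((g.isInvertible_metricRep hp).contDiffAt_map_inverse (n := ∞)).comp p
    (g.contDiffAt_metricRep hp)
  exact tr.contDiff.contDiffAt.comp p (h1.clm_comp (g.contDiffAt_covRep hu hp))

end LorentzMetric

/-! ### The Hodge dual and Lorentzian linear algebra -/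

theorem sum_eq_six_mul {F : Fin 4 → Fin 4 → Fin 4 → ℝ} (h₁ : ∀ i j k, F i j k = F j i k)
    (h₂ : ∀ i j k, F i j k = F i k j) (hd : ∀ i k, F i i k = 0) (h₃ : ∀ j k, F 3 j k = 0) :
    ∑ i, ∑ j, ∑ k, F i j k = 6 * F 0 1 2 := by
  have hd' : ∀ i k, F i k k = 0 := fun i k ↦ by rw [h₁, h₂, hd]
  have hd'' : ∀ i k, F i k i = 0 := fun i k ↦ by rw [h₂, hd]
  have h₃' : ∀ j k, F j 3 k = 0 := fun j k ↦ by rw [h₁, h₃]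
  have h₃'' : ∀ j k, F j k 3 = 0 := fun j k ↦ by rw [h₂, h₃']
  have e1 : F 0 2 1 = F 0 1 2 := h₂ _ _ _
  have e2 : F 1 0 2 = F 0 1 2 := h₁ _ _ _
  have e3 : F 1 2 0 = F 0 1 2 := by rw [h₂, e2]
  have e4 : F 2 0 1 = F 0 1 2 := by rw [h₁, e1]
  have e5 : F 2 1 0 = F 0 1 2 := by rw [h₂, e4]
  simp only [Fin.sum_univ_four, hd, hd', hd'', h₃, h₃', h₃'', e1, e2, e3, e4, e5]
  ring

theorem wedge12_cyclic {x : M} (α : Tan x →L[ℝ] ℝ) (B : Tan x → Tan x → ℝ) (X Y Z : Tan x) :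
    wedge12 α B X Y Z = wedge12 α B Y Z X := by
  simp only [wedge12]; ring

theorem wedge12_swap {x : M} (α : Tan x →L[ℝ] ℝ) {B : Tan x → Tan x → ℝ}
    (hB : ∀ X Y, B X Y = -B Y X) (X Y Z : Tan x) :
    wedge12 α B X Y Z = -wedge12 α B Y X Z := by
  simp only [wedge12]
  rw [hB Y Z, hB Z X, hB X Y]
  ring

/-- Linearity is used in the last slot only; cyclic rotation brings each slot there in turn. -/
theorem wedge12_eq_zero_of_basis {x : M} (α : Tan x →L[ℝ] ℝ) (B : Tan x →ₗ[ℝ] Tan x →ₗ[ℝ] ℝ)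
    (e : Module.Basis (Fin 4) ℝ (Tan x))
    (h : ∀ i j k, wedge12 α (fun X Y ↦ B X Y) (e i) (e j) (e k) = 0) (X Y Z : Tan x) :
    wedge12 α (fun X Y ↦ B X Y) X Y Z = 0 := by
  have key : ∀ X Y, (∀ k, wedge12 α (fun X Y ↦ B X Y) X Y (e k) = 0) →
      ∀ Z, wedge12 α (fun X Y ↦ B X Y) X Y Z = 0 := by
    intro X Y h Z
    have : α X • B Y + α Y • B.flip X + B X Y • α.toLinearMap = 0 := e.ext fun k ↦ by
      have := h k
      simp only [wedge12] at this
      simp only [LinearMap.add_apply, LinearMap.smul_apply, LinearMap.flip_apply, smul_eq_mul,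
        ContinuousLinearMap.coe_coe, LinearMap.zero_apply]
      linear_combination this
    have := congr($this Z)
    simp only [LinearMap.add_apply, LinearMap.smul_apply, LinearMap.flip_apply, smul_eq_mul,
      ContinuousLinearMap.coe_coe, LinearMap.zero_apply] at this
    simp only [wedge12]
    linear_combination this
  refine key X Y (fun k ↦ ?_) Z
  rw [← wedge12_cyclic]
  refine key _ X (fun j ↦ ?_) Y
  rw [← wedge12_cyclic]
  exact key _ _ (fun i ↦ h j k i) X

namespace LorentzMetric

variable (g : LorentzMetric M) {u : ∀ x : M, Tan x}

theorem vol_frame_ne_zero (o : ManifoldOrientation M) (x : M) (σ : Equiv.Perm (Fin 4)) :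
    g.vol o x (fun i ↦ g.frame x (σ i)) ≠ 0 := by
  have h1 : g.vol o x (g.frame x) ≠ 0 := by
    unfold vol
    split
    · rw [Module.Basis.det_self]; exact one_ne_zero
    · rw [AlternatingMap.neg_apply, Module.Basis.det_self]; norm_num
  have h2 := (g.vol o x).map_perm (g.frame x) σ
  show g.vol o x (g.frame x ∘ σ) ≠ 0
  rw [h2]
  rcases Int.units_eq_one_or (Equiv.Perm.sign σ) with h | h <;> rw [h] <;> simpa using h1

/-- Up to sign, each frame component of the dual is the value of the three-form on the complementary
triple of frame vectors. -/
theorem hodge3_eq_zero_iff (o : ManifoldOrientation M) {x : M} (α : Tan x →L[ℝ] ℝ)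
    (B : Tan x →ₗ[ℝ] Tan x →ₗ[ℝ] ℝ) (hB : ∀ X Y, B X Y = -B Y X) :
    g.hodge3 o (wedge12 α fun X Y ↦ B X Y) = 0 ↔
      ∀ X Y Z, wedge12 α (fun X Y ↦ B X Y) X Y Z = 0 := by
  constructor
  · intro h
    refine wedge12_eq_zero_of_basis α B (g.frame x) fun i j k ↦ ?_
    set e := g.frame x
    have hs1 := wedge12_swap α hB
    have hs2 : ∀ X Y Z, wedge12 α (fun X Y ↦ B X Y) X Y Z = -wedge12 α (fun X Y ↦ B X Y) X Z Y :=
      fun X Y Z ↦ by rw [wedge12_cyclic, hs1, wedge12_cyclic, wedge12_cyclic]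
    have hd : ∀ X Z, wedge12 α (fun X Y ↦ B X Y) X X Z = 0 := fun X Z ↦ by
      linarith [hs1 X X Z]
    -- Either an index repeats and antisymmetry applies, or the triple completes to a permutation,
    -- whose fourth index selects the component of the dual to inspect.
    have hcases : ∀ i j k : Fin 4, i = j ∨ j = k ∨ i = k ∨
        ∃ l, Function.Injective ![i, j, k, l] := by decide
    rcases hcases i j k with rfl | rfl | rfl | ⟨l, hl⟩
    · exact hd _ _
    · rw [wedge12_cyclic]; exact hd _ _
    · rw [hs2, hd, neg_zero]
    let σ : Equiv.Perm (Fin 4) := Equiv.ofBijective _ (Finite.injective_iff_bijective.1 hl)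
    have h0 : (1 / 6) * ∑ i, ∑ j, ∑ k, sgn i * sgn j * sgn k *
        wedge12 α (fun X Y ↦ B X Y) (e i) (e j) (e k) *
        g.vol o x ![e i, e j, e k, e l] = 0 := by
      have h1 := congr(e.repr $h l)
      simp only [hodge3, sharp, map_sum, map_smul, Module.Basis.repr_self, e, map_zero,
        Finsupp.coe_finsetSum, Finset.sum_apply, Finsupp.smul_apply, Finsupp.single_apply,
        smul_eq_mul, mul_ite, mul_one, mul_zero, Finset.sum_ite_eq', Finset.mem_univ, if_true,
        Finsupp.coe_zero, Pi.zero_apply] at h1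
      have h2 := sgn_mul_self l
      rw [mul_eq_zero] at h1
      rcases h1 with h1 | h1
      · rw [h1] at h2; norm_num at h2
      · exact h1
    let G : Fin 4 → Fin 4 → Fin 4 → ℝ := fun i j k ↦ sgn i * sgn j * sgn k *
        wedge12 α (fun X Y ↦ B X Y) (e i) (e j) (e k) * g.vol o x ![e i, e j, e k, e l]
    let F : Fin 4 → Fin 4 → Fin 4 → ℝ := fun i j k ↦ G (σ i) (σ j) (σ k)
    have hv1 : ∀ a b c d : Tan x, g.vol o x ![a, b, c, d] = -g.vol o x ![b, a, c, d] := by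
      intro a b c d
      rw [← (g.vol o x).map_swap ![b, a, c, d] (show (0 : Fin 4) ≠ 1 by decide)]
      congr 1
      funext m
      fin_cases m <;> rfl
    have hv2 : ∀ a b c d : Tan x, g.vol o x ![a, b, c, d] = -g.vol o x ![a, c, b, d] := by
      intro a b c d
      rw [← (g.vol o x).map_swap ![a, c, b, d] (show (1 : Fin 4) ≠ 2 by decide)]
      congr 1
      funext m
      fin_cases m <;> rfl
    -- The product of two alternating factors is symmetric. After reindexing by σ, terms with index
    -- 3 repeat `e l` in the volume form, so only the six orderings of 0, 1, 2 survive.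
    have hF : ∑ i, ∑ j, ∑ k, F i j k = 6 * F 0 1 2 := by
      refine sum_eq_six_mul (fun i j k ↦ ?_) (fun i j k ↦ ?_) (fun i k ↦ ?_) (fun j k ↦ ?_)
      · simp only [F, G]
        rw [hs1 (e (σ i)), hv1 (e (σ i))]
        ring
      · simp only [F, G]
        rw [hs2 (e (σ i)), hv2 (e (σ i))]
        ring
      · simp only [F, G, hd]
        ring
      · have : g.vol o x ![e (σ 3), e (σ j), e (σ k), e l] = 0 :=
          (g.vol o x).map_eq_zero_of_eq _ (i := 0) (j := 3) rfl (by decide)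
        simp only [F, G, this]
        ring
    have hF' : ∑ i, ∑ j, ∑ k, F i j k = ∑ i, ∑ j, ∑ k, G i j k := by
      refine .trans ?_ (Equiv.sum_comp σ fun i ↦ ∑ j, ∑ k, G i j k)
      refine Finset.sum_congr rfl fun i _ ↦ ?_
      refine .trans ?_ (Equiv.sum_comp σ fun j ↦ ∑ k, G (σ i) j k)
      exact Finset.sum_congr rfl fun j _ ↦ Equiv.sum_comp σ fun k ↦ G (σ i) (σ j) k
    have h0' : ∑ i, ∑ j, ∑ k, G i j k = 0 := by
      simp only [G]
      linarith
    rw [← hF', hF] at h0'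
    have h1 : F 0 1 2 = 0 := by linarith
    have hvol : g.vol o x ![e i, e j, e k, e l] ≠ 0 := by
      convert g.vol_frame_ne_zero o x σ using 2
      funext m
      fin_cases m <;> rfl
    have hsgn : ∀ i, sgn i ≠ 0 := fun i h ↦ by
      have := sgn_mul_self i
      rw [h] at this; norm_num at this
    have h2 : sgn i * sgn j * sgn k * wedge12 α (fun X Y ↦ B X Y) (e i) (e j) (e k) *
        g.vol o x ![e i, e j, e k, e l] = 0 := h1
    simpa [hsgn, hvol] using h2
  · intro h
    simp [hodge3, sharp, h]

theorem inner_eq_sum (x : M) (v w : Tan x) : g.inner x v w =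
    ∑ i, sgn i * (g.frame x).repr v i * (g.frame x).repr w i := by
  conv_lhs => rw [← (g.frame x).sum_repr v]
  simp only [map_sum, map_smul, sum_apply, smul_apply, smul_eq_mul]
  refine Finset.sum_congr rfl fun i _ ↦ ?_
  rw [g.frame_repr x w, g.symm x w]
  linear_combination (-(g.frame x).repr v i * g.inner x (g.frame x i) w) * sgn_mul_self i

/-- A nonzero vector orthogonal to a unit time-like vector is not light-like. -/
theorem inner_self_ne_zero {x : M} {v w : Tan x} (hw : g.inner x w w = -1)
    (hvw : g.inner x v w = 0) (hv : v ≠ 0) : g.inner x v v ≠ 0 := by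
  intro h
  refine hv ((g.frame x).repr.injective ?_)
  rw [inner_eq_sum, Fin.sum_univ_four] at hw hvw h
  simp only [sgn, Fin.isValue, if_true, Fin.reduceEq, if_false, one_ne_zero] at hw hvw h
  set a := (g.frame x).repr v
  set b := (g.frame x).repr w
  -- Lagrange's identity for the spatial parts: with a null, b unit time-like and a orthogonal to b,
  -- the squared norm of their cross product is a₀²(b₀² - 1) - a₀²b₀² = -a₀².
  have h0 : a 0 ^ 2 + (a 1 * b 2 - a 2 * b 1) ^ 2 + (a 1 * b 3 - a 3 * b 1) ^ 2 +
      (a 2 * b 3 - a 3 * b 2) ^ 2 = 0 := by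
    have e1 : a 1 ^ 2 + a 2 ^ 2 + a 3 ^ 2 = a 0 ^ 2 := by linear_combination h
    have e2 : b 1 ^ 2 + b 2 ^ 2 + b 3 ^ 2 = b 0 ^ 2 - 1 := by linear_combination hw
    have e3 : a 1 * b 1 + a 2 * b 2 + a 3 * b 3 = a 0 * b 0 := by linear_combination hvw
    linear_combination (b 1 ^ 2 + b 2 ^ 2 + b 3 ^ 2) * e1 + a 0 ^ 2 * e2 -
      (a 1 * b 1 + a 2 * b 2 + a 3 * b 3 + a 0 * b 0) * e3
  have ha0 : a 0 = 0 := by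
    have : a 0 ^ 2 ≤ 0 := by
      linarith [sq_nonneg (a 1 * b 2 - a 2 * b 1), sq_nonneg (a 1 * b 3 - a 3 * b 1),
        sq_nonneg (a 2 * b 3 - a 3 * b 2)]
    exact pow_eq_zero_iff two_ne_zero |>.1 (le_antisymm this (sq_nonneg _))
  rw [ha0] at h
  have ha : ∀ i, a i = 0 := by
    have h1 : a 1 = 0 := by nlinarith [sq_nonneg (a 1), sq_nonneg (a 2), sq_nonneg (a 3)]
    have h2 : a 2 = 0 := by nlinarith [sq_nonneg (a 1), sq_nonneg (a 2), sq_nonneg (a 3)]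
    have h3 : a 3 = 0 := by nlinarith [sq_nonneg (a 1), sq_nonneg (a 2), sq_nonneg (a 3)]
    intro i
    fin_cases i
    exacts [ha0, h1, h2, h3]
  rw [map_zero]
  exact Finsupp.ext ha

end LorentzMetric

/-! ### Differences of solutions and the constraints they impose -/

theorem differential_sub {f k : M → ℝ} {x : M} (hf : ContMDiffAt (𝓡 4) 𝓘(ℝ, ℝ) ∞ f x)
    (hk : ContMDiffAt (𝓡 4) 𝓘(ℝ, ℝ) ∞ k x) (X : Tan x) :
    differential (fun y ↦ f y - k y) x X = differential f x X - differential k x X := by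
  obtain ⟨x₀, p, hp, rfl⟩ := exists_chartInv_eq x
  obtain ⟨X, rfl⟩ := exists_chartFrame_eq hp X
  have hf' := (contDiffAt_comp_chartInv hp hf).differentiableAt (by simp)
  have hk' := (contDiffAt_comp_chartInv hp hk).differentiableAt (by simp)
  have h : HasFDerivAt ((fun y ↦ f y - k y) ∘ chartInv x₀) _ p :=
    hf'.hasFDerivAt.sub hk'.hasFDerivAt
  rw [differential_chartFrame hp h.differentiableAt, differential_chartFrame hp hf',
    differential_chartFrame hp hk', h.fderiv, sub_apply]

theorem differential_mul {f k : M → ℝ} {x : M} (hf : ContMDiffAt (𝓡 4) 𝓘(ℝ, ℝ) ∞ f x)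
    (hk : ContMDiffAt (𝓡 4) 𝓘(ℝ, ℝ) ∞ k x) (X : Tan x) :
    differential (fun y ↦ f y * k y) x X =
      f x * differential k x X + k x * differential f x X := by
  obtain ⟨x₀, p, hp, rfl⟩ := exists_chartInv_eq x
  obtain ⟨X, rfl⟩ := exists_chartFrame_eq hp X
  have hf' := (contDiffAt_comp_chartInv hp hf).differentiableAt (by simp)
  have hk' := (contDiffAt_comp_chartInv hp hk).differentiableAt (by simp)
  have h : HasFDerivAt ((fun y ↦ f y * k y) ∘ chartInv x₀) _ p :=
    hf'.hasFDerivAt.mul hk'.hasFDerivAt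
  rw [differential_chartFrame hp h.differentiableAt, differential_chartFrame hp hf',
    differential_chartFrame hp hk', h.fderiv]
  rfl

theorem differential_congr {f k : M → ℝ} {x : M} (h : f =ᶠ[𝓝 x] k) :
    differential f x = differential k x := by
  simp only [differential, mvfderiv, h.mfderiv_eq]
  rfl

namespace LorentzMetric

variable (g : LorentzMetric M) {u : ∀ x : M, Tan x}

theorem flat_self (hu : g.IsUnitTimelike u) (x : M) : g.flat u x (u x) = -1 := hu.2 x

theorem flat_accel_self (hu : g.IsUnitTimelike u) (x : M) :
    g.flat (g.accel u) x (u x) = 0 := by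
  obtain ⟨B, hB, hB'⟩ := extD_bilinear (g.formSmoothAt_flat hu x)
  rw [g.flat_accel_apply hu, hB]
  linarith [hB' (u x) (u x)]

theorem flat_apply_accel (hu : g.IsUnitTimelike u) (x : M) :
    g.flat u x (g.accel u x) = 0 :=
  (g.symm x _ _).trans (g.flat_accel_self hu x)

theorem flat_accel_accel_ne_zero (hu : g.IsUnitTimelike u) {x : M} (ha : g.accel u x ≠ 0) :
    g.flat (g.accel u) x (g.accel u x) ≠ 0 :=
  g.inner_self_ne_zero (hu.2 x) (g.flat_accel_self hu x) ha

theorem accelVorticity_eq_zero_iff (hu : g.IsUnitTimelike u) (o : ManifoldOrientation M) (x : M) :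
    g.accelVorticity u o x = 0 ↔ ∀ X Y Z,
      wedge12 (g.flat (g.accel u) x) (extD (g.flat (g.accel u)) x) X Y Z = 0 := by
  obtain ⟨B, hB, hB'⟩ := extD_bilinear (g.formSmoothAt_accel hu x)
  have h : extD (g.flat (g.accel u)) x = fun X Y ↦ B X Y := by
    funext X Y
    exact hB X Y
  rw [accelVorticity, h]
  exact g.hodge3_eq_zero_iff o _ B hB'

theorem nu_eq_zero_iff (hu : g.IsUnitTimelike u) {x : M} (ha : g.accel u x ≠ 0)
    (hθ : g.expansion u x ≠ 0) :
    g.nu u x = 0 ↔ differential (g.expansion u) x (g.accel u x) =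
      -2 * (g.expansion u x * g.flat (g.accel u) x (g.accel u x)) := by
  have h : g.expansion u x * g.inner x (g.accel u x) (g.accel u x) ≠ 0 :=
    mul_ne_zero hθ (g.flat_accel_accel_ne_zero hu ha)
  have h' : g.nu u x * (g.expansion u x * g.flat (g.accel u) x (g.accel u x)) =
      2 * (g.expansion u x * g.flat (g.accel u) x (g.accel u x)) +
      differential (g.expansion u) x (g.accel u x) := by
    rw [nu, add_mul]
    exact congrArg _ (div_mul_cancel₀ _ h)
  constructor
  · intro hν
    rw [hν] at h'
    linear_combination -h'
  · intro hd
    rw [hd] at h'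
    refine (mul_eq_zero_iff_right h).1 (h'.trans (by ring))

variable {g} {γ : ℝ} {f f₀ : M → ℝ} {U : Set M} {x : M}

theorem IsSolutionOn.contMDiffAt (hf : g.IsSolutionOn u γ f U) (hU : IsOpen U) (hx : x ∈ U) :
    ContMDiffAt (𝓡 4) 𝓘(ℝ, ℝ) ∞ f x :=
  hf.1.contMDiffAt (hU.mem_nhds hx)

theorem IsSolutionOn.mono {V : Set M} (hf : g.IsSolutionOn u γ f U) (hV : V ⊆ U) :
    g.IsSolutionOn u γ f V :=
  ⟨hf.1.mono hV, fun x hx ↦ hf.2 x (hV hx)⟩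

theorem extD_momentum (hu : g.IsUnitTimelike u) (hf : ContMDiffAt (𝓡 4) 𝓘(ℝ, ℝ) ∞ f x)
    (X Y : Tan x) :
    extD (fun y ↦ g.expansion u y • g.flat u y - f y • g.flat (g.accel u) y) x X Y =
      differential (g.expansion u) x X * g.flat u x Y -
      differential (g.expansion u) x Y * g.flat u x X +
      g.expansion u x * extD (g.flat u) x X Y -
      (differential f x X * g.flat (g.accel u) x Y - differential f x Y * g.flat (g.accel u) x X +
        f x * extD (g.flat (g.accel u)) x X Y) := by
  have h1 := g.formSmoothAt_flat hu x
  have h2 := g.formSmoothAt_accel hu x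
  have h3 : ContMDiffAt (𝓡 4) 𝓘(ℝ, ℝ) ∞ (g.expansion u) x := (g.contMDiff_expansion hu).contMDiffAt
  rw [extD_sub (h1.smul h3) (h2.smul hf), extD_smul h1 h3, extD_smul h2 hf]

/-- The system is affine in f: the source -θ and the form θu do not involve f and drop out. -/
theorem IsSolutionOn.sub (hu : g.IsUnitTimelike u) (hU : IsOpen U) (hx : x ∈ U)
    (hf : g.IsSolutionOn u γ f U) (hf₀ : g.IsSolutionOn u γ f₀ U) :
    differential (fun y ↦ f y - f₀ y) x (u x) =
      g.expansion u x * ((γ - 1) * (f x - f₀ x)) ∧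
    ∀ X Y, differential (fun y ↦ f y - f₀ y) x X * g.flat (g.accel u) x Y -
      differential (fun y ↦ f y - f₀ y) x Y * g.flat (g.accel u) x X +
      (f x - f₀ x) * extD (g.flat (g.accel u)) x X Y = 0 := by
  have h1 := hf.contMDiffAt hU hx
  have h2 := hf₀.contMDiffAt hU hx
  constructor
  · rw [differential_sub h1 h2]
    linear_combination (hf.2 x hx).1 - (hf₀.2 x hx).1
  · intro X Y
    have e1 := (hf.2 x hx).2 X Y
    have e2 := (hf₀.2 x hx).2 X Y
    rw [extD_momentum hu h1] at e1
    rw [extD_momentum hu h2] at e2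
    rw [differential_sub h1 h2, differential_sub h1 h2]
    linear_combination e2 - e1

theorem isSolutionOn_add {h : M → ℝ} (hu : g.IsUnitTimelike u) (hU : IsOpen U)
    (hf₀ : g.IsSolutionOn u γ f₀ U) (hh : ContMDiffOn (𝓡 4) 𝓘(ℝ, ℝ) ∞ h U)
    (h1 : ∀ x ∈ U, differential h x (u x) = g.expansion u x * ((γ - 1) * h x))
    (h2 : ∀ x ∈ U, ∀ X Y, differential h x X * g.flat (g.accel u) x Y -
      differential h x Y * g.flat (g.accel u) x X +
      h x * extD (g.flat (g.accel u)) x X Y = 0) :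
    g.IsSolutionOn u γ (fun x ↦ f₀ x + h x) U := by
  have hs : ContMDiffOn (𝓡 4) 𝓘(ℝ, ℝ) ∞ (fun x ↦ f₀ x + h x) U := hf₀.1.add hh
  have hd : ∀ x ∈ U, ∀ X, differential (fun x ↦ f₀ x + h x) x X =
      differential f₀ x X + differential h x X := by
    intro x hx X
    -- The sum rule, obtained by subtracting h from f₀ + h.
    have := differential_sub (hs.contMDiffAt (hU.mem_nhds hx)) (hh.contMDiffAt (hU.mem_nhds hx)) X
    simp only [add_sub_cancel_right] at this
    linear_combination -this
  refine ⟨hs, fun x hx ↦ ⟨?_, fun X Y ↦ ?_⟩⟩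
  · rw [hd x hx]
    linear_combination (hf₀.2 x hx).1 + h1 x hx
  · have e := (hf₀.2 x hx).2 X Y
    rw [extD_momentum hu (hf₀.contMDiffAt hU hx)] at e
    rw [extD_momentum hu (hs.contMDiffAt (hU.mem_nhds hx)), hd x hx, hd x hx]
    linear_combination e - h2 x hx X Y

/-- The contraction of the momentum equation with `u`. -/
theorem IsSolutionOn.contract (hu : g.IsUnitTimelike u) (hU : IsOpen U) (hx : x ∈ U)
    (hf : g.IsSolutionOn u γ f U) (Y : Tan x) :
    differential (g.expansion u) x Y + differential (g.expansion u) x (u x) * g.flat u x Y +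
      2 * g.expansion u x * g.flat (g.accel u) x Y =
    f x * (extD (g.flat (g.accel u)) x (u x) Y +
      (γ - 1) * g.expansion u x * g.flat (g.accel u) x Y) := by
  have e := (hf.2 x hx).2 (u x) Y
  rw [extD_momentum hu (hf.contMDiffAt hU hx), (hf.2 x hx).1, g.flat_self hu, g.flat_accel_self hu,
    ← g.flat_accel_apply hu] at e
  linear_combination e

/-- If two solutions differ at a point, then the acceleration is integrable there, it is scaled
by the flow of `u`, and the expansion has a prescribed spatial gradient. -/
theorem IsSolutionOn.constraints_of_ne (hu : g.IsUnitTimelike u) (hU : IsOpen U) (hx : x ∈ U)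
    (hf : g.IsSolutionOn u γ f U) (hf₀ : g.IsSolutionOn u γ f₀ U) (hne : f x ≠ f₀ x) :
    (∀ X Y Z, wedge12 (g.flat (g.accel u) x) (extD (g.flat (g.accel u)) x) X Y Z = 0) ∧
    ∀ Y, differential (g.expansion u) x Y +
      differential (g.expansion u) x (u x) * g.flat u x Y +
      2 * g.expansion u x * g.flat (g.accel u) x Y = 0 := by
  obtain ⟨h1, h2⟩ := hf.sub hu hU hx hf₀
  have hne' : f x - f₀ x ≠ 0 := sub_ne_zero.2 hne
  constructor
  · intro X Y Z
    refine (mul_eq_zero_iff_left hne').1 ?_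
    simp only [wedge12]
    -- The equation dh ∧ a + h da = 0 wedged with a.
    linear_combination g.flat (g.accel u) x X * h2 Y Z + g.flat (g.accel u) x Y * h2 Z X +
      g.flat (g.accel u) x Z * h2 X Y
  · intro Y
    have h3 : extD (g.flat (g.accel u)) x (u x) Y +
        (γ - 1) * g.expansion u x * g.flat (g.accel u) x Y = 0 := by
      refine (mul_eq_zero_iff_left hne').1 ?_
      have := h2 (u x) Y
      rw [h1, g.flat_accel_self hu] at this
      linear_combination this
    rw [hf.contract hu hU hx, h3, mul_zero]

/-- Since a(u) = 0, the condition a ∧ da = 0 on (u, Y, a) gives a² da(u, Y) = a(Y) da(u, a). This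
reduces the claim to Y = a, where ν = 0 cancels the left side of the contracted equation. Division
by a² is allowed because a is orthogonal to u and nonzero. -/
theorem IsSolutionOn.mul_extD_accel_eq_zero (hu : g.IsUnitTimelike u) (ha : g.accel u x ≠ 0)
    (hθ : g.expansion u x ≠ 0) (hU : IsOpen U) (hx : x ∈ U)
    (hf : g.IsSolutionOn u γ f U)
    (hv : ∀ X Y Z, wedge12 (g.flat (g.accel u) x) (extD (g.flat (g.accel u)) x) X Y Z = 0)
    (hν : g.nu u x = 0) (Y : Tan x) :
    f x * (extD (g.flat (g.accel u)) x (u x) Y +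
      (γ - 1) * g.expansion u x * g.flat (g.accel u) x Y) = 0 := by
  have hν' := (g.nu_eq_zero_iff hu ha hθ).1 hν
  have h1 := hf.contract hu hU hx (g.accel u x)
  rw [hν', g.flat_apply_accel hu] at h1
  have h2 := hv (u x) Y (g.accel u x)
  obtain ⟨B, hB, hB'⟩ := extD_bilinear (g.formSmoothAt_accel hu x)
  simp only [wedge12, g.flat_accel_self hu, hB] at h2
  simp only [hB] at h1 ⊢
  rw [hB' (g.accel u x) (u x)] at h2
  refine (mul_eq_zero_iff_left (g.flat_accel_accel_ne_zero hu ha)).1 ?_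
  linear_combination f x * h2 - g.flat (g.accel u) x Y * h1

end LorentzMetric

/-! ### Integrable acceleration and the general solution -/

theorem isOpen_chartDom_inter_preimage {W : Set M} (hW : IsOpen W) (x₀ : M) :
    IsOpen (chartDom x₀ ∩ chartInv x₀ ⁻¹' W) :=
  (contMDiffOn_chartInv x₀).continuousOn.isOpen_inter_preimage (isOpen_chartDom x₀) hW

theorem isOpen_source_inter_preimage {V : Set R4} (hV : IsOpen V) (x₀ : M) :
    IsOpen ((extChartAt (𝓡 4) x₀).source ∩ extChartAt (𝓡 4) x₀ ⁻¹' V) :=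
  (continuousOn_extChartAt x₀).isOpen_inter_preimage (isOpen_extChartAt_source x₀) hV

theorem comp_extChartAt_comp_chartInv (k : R4 → ℝ) {x₀ : M} {p : R4} (hp : p ∈ chartDom x₀) :
    (k ∘ extChartAt (𝓡 4) x₀) ∘ chartInv x₀ =ᶠ[𝓝 p] k := by
  filter_upwards [(isOpen_chartDom x₀).mem_nhds hp] with q hq
  exact congrArg k (chart_chartInv hq)

/-- A function that is continuous in a chart and vanishes on `S` vanishes on the closure of `S`. -/
theorem eq_zero_of_chartInv_mem_closure {c : R4 → ℝ} {S : Set M} {x₀ : M} {p : R4}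
    (hp : p ∈ chartDom x₀) (hc : ContinuousAt c p) (hS : chartInv x₀ p ∈ closure S)
    (h : ∀ q ∈ chartDom x₀, chartInv x₀ q ∈ S → c q = 0) : c p = 0 := by
  have hs : chartInv x₀ p ∈ (extChartAt (𝓡 4) x₀).source := by simpa using mem_source_chartInv hp
  have h1 : ContinuousAt (c ∘ extChartAt (𝓡 4) x₀) (chartInv x₀ p) := by
    refine ContinuousAt.comp ?_ (continuousAt_extChartAt' hs)
    rwa [chart_chartInv hp]
  have := mem_closure_iff_nhdsWithin_neBot.1 hS
  have h2 : (c ∘ extChartAt (𝓡 4) x₀) =ᶠ[𝓝[S] chartInv x₀ p] fun _ ↦ 0 := by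
    filter_upwards [self_mem_nhdsWithin,
      mem_nhdsWithin_of_mem_nhds ((isOpen_extChartAt_source x₀).mem_nhds hs)] with y hy hys
    refine h _ ((extChartAt (𝓡 4) x₀).map_source hys) ?_
    have : chartInv x₀ (extChartAt (𝓡 4) x₀ y) = y := (extChartAt (𝓡 4) x₀).left_inv hys
    rwa [this]
  have h3 := tendsto_nhds_unique (h1.mono_left nhdsWithin_le_nhds)
    (tendsto_const_nhds.congr' h2.symm)
  rwa [Function.comp_apply, chart_chartInv hp] at h3

/-- The image of W under α need not be open, so only a derivative of φ within it is available. As α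
maps the open set W into it, the composite still has a genuine derivative. -/
theorem exists_differential_comp {α : M → ℝ} {φ : ℝ → ℝ} {W : Set M} (hW : IsOpen W)
    (hα : ContMDiffOn (𝓡 4) 𝓘(ℝ, ℝ) ∞ α W) (hφ : ContDiffOn ℝ ∞ φ (α '' W)) {x : M}
    (hx : x ∈ W) : ∃ c : ℝ, ∀ X, differential (fun y ↦ φ (α y)) x X = c * differential α x X := by
  obtain ⟨x₀, p, hp, rfl⟩ := exists_chartInv_eq x
  have hα' := contDiffAt_comp_chartInv hp (hα.contMDiffAt (hW.mem_nhds hx))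
  have hα'' := (hα'.differentiableAt (by simp)).hasFDerivAt
  have hφ' := ((hφ _ (Set.mem_image_of_mem α hx)).differentiableWithinAt
    (by simp)).hasFDerivWithinAt
  have hS := (isOpen_chartDom_inter_preimage hW x₀).mem_nhds ⟨hp, hx⟩
  have h : HasFDerivAt ((fun y ↦ φ (α y)) ∘ chartInv x₀) _ p :=
    (hφ'.comp (f := α ∘ chartInv x₀) p hα''.hasFDerivWithinAt
      (fun q hq ↦ Set.mem_image_of_mem α hq.2)).hasFDerivAt hS
  refine ⟨fderivWithin ℝ φ (α '' W) (α (chartInv x₀ p)) 1, fun X ↦ ?_⟩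
  obtain ⟨X, rfl⟩ := exists_chartFrame_eq hp X
  rw [differential_chartFrame hp h.differentiableAt,
    differential_chartFrame hp hα''.differentiableAt, h.fderiv, ContinuousLinearMap.comp_apply]
  conv_lhs => rw [← mul_one (fderiv ℝ (α ∘ chartInv x₀) p X), ← smul_eq_mul, map_smul]
  rw [smul_eq_mul, mul_comm]

namespace LorentzMetric

variable {g : LorentzMetric M} {u : ∀ x : M, Tan x} {γ : ℝ} {f f₀ : M → ℝ} {U W : Set M} {x : M}

/-- The bracket b of `IsSolutionOn.mul_extD_accel_eq_zero` satisfies f b = 0. Zeros of f are no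
exception: there u(f) = -θ ≠ 0, so differentiating f b = 0 along u gives b = 0. -/
theorem IsSolutionOn.extD_accel_apply (hu : g.IsUnitTimelike u) (ha : ∀ x, g.accel u x ≠ 0)
    (hθ : ∀ x, g.expansion u x ≠ 0) (hU : IsOpen U) (hf : g.IsSolutionOn u γ f U)
    (hv : ∀ x ∈ U, ∀ X Y Z,
      wedge12 (g.flat (g.accel u) x) (extD (g.flat (g.accel u)) x) X Y Z = 0)
    (hν : ∀ x ∈ U, g.nu u x = 0) (hx : x ∈ U) (Y : Tan x) :
    extD (g.flat (g.accel u)) x (u x) Y =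
      -((γ - 1) * g.expansion u x * g.flat (g.accel u) x Y) := by
  refine eq_neg_of_add_eq_zero_left ?_
  have key : ∀ x ∈ U, ∀ Y, f x * (extD (g.flat (g.accel u)) x (u x) Y +
      (γ - 1) * g.expansion u x * g.flat (g.accel u) x Y) = 0 := fun x hx Y ↦
    hf.mul_extD_accel_eq_zero hu (ha x) (hθ x) hU hx (hv x hx) (hν x hx) Y
  by_cases h0 : f x ≠ 0
  · exact (mul_eq_zero_iff_left h0).1 (key x hx Y)
  push Not at h0
  obtain ⟨x₀, p, hp, rfl⟩ := exists_chartInv_eq x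
  obtain ⟨Y, rfl⟩ := exists_chartFrame_eq hp Y
  let η := formRep (g.flat (g.accel u)) x₀
  let b : R4 → ℝ := fun q ↦ extDNormed η q (vecRep u x₀ q) Y +
    (γ - 1) * (g.expansion u ∘ chartInv x₀) q * η q Y
  have hb : ∀ q ∈ chartDom x₀, extD (g.flat (g.accel u)) (chartInv x₀ q) (u (chartInv x₀ q))
      (chartFrame x₀ q Y) + (γ - 1) * g.expansion u (chartInv x₀ q) *
        g.flat (g.accel u) (chartInv x₀ q) (chartFrame x₀ q Y) = b q := by
    intro q hq
    rw [← chartFrame_vecRep u hq,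
      extD_chartFrame hq ((g.formSmoothAt_accel hu _).differentiableAt hq)]
    rfl
  have hη : ContDiffAt ℝ ∞ η p := g.formSmoothAt_accel hu _ x₀ p hp rfl
  have hη' : ContDiffAt ℝ ∞ (fderiv ℝ η) p := hη.fderiv_right (by simp)
  have hû := g.contDiffAt_vecRep hu hp
  have hθ' := contDiffAt_comp_chartInv hp (g.contMDiff_expansion hu).contMDiffAt
  have hbs : ContDiffAt ℝ ∞ b p :=
    (((hη'.clm_apply hû).clm_apply contDiffAt_const).sub
      ((hη'.clm_apply contDiffAt_const).clm_apply hû)).add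
      ((contDiffAt_const.mul hθ').mul (hη.clm_apply contDiffAt_const))
  have hbd := (hbs.differentiableAt (by simp)).hasFDerivAt
  have hfd := ((contDiffAt_comp_chartInv hp (hf.contMDiffAt hU hx)).differentiableAt
    (by simp)).hasFDerivAt
  -- With Y frozen as a coordinate vector, f b vanishes on a neighbourhood and not only at p, so its
  -- derivative is zero.
  have h1 : HasFDerivAt (fun q ↦ (f ∘ chartInv x₀) q * b q) (0 : R4 →L[ℝ] ℝ) p := by
    refine (hasFDerivAt_const (0 : ℝ) p).congr_of_eventuallyEq ?_
    filter_upwards [(isOpen_chartDom_inter_preimage hU x₀).mem_nhds ⟨hp, hx⟩] with q hq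
    rw [← hb q hq.1]
    exact key _ hq.2 _
  have h2 := congr($((hfd.mul hbd).unique h1) (vecRep u x₀ p))
  have h3 := (hf.2 _ hx).1
  rw [← chartFrame_vecRep u hp, differential_chartFrame hp hfd.differentiableAt, h0] at h3
  simp only [smul_apply, Function.comp_apply, h0, zero_smul, zero_add, smul_eq_mul,
    zero_apply] at h2
  rw [h3] at h2
  rw [hb p hp]
  refine (mul_eq_zero_iff_right (hθ (chartInv x₀ p))).1 ?_
  linear_combination -h2

/-- The Frobenius theorem for the acceleration. -/
theorem exists_isPotentialOn (hu : g.IsUnitTimelike u) (ha : g.accel u x ≠ 0) (hW : IsOpen W)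
    (hv : ∀ x ∈ W, ∀ X Y Z,
      wedge12 (g.flat (g.accel u) x) (extD (g.flat (g.accel u)) x) X Y Z = 0) (hx : x ∈ W) :
    ∃ V, IsOpen V ∧ x ∈ V ∧ V ⊆ W ∧ ∃ α β : M → ℝ, g.IsPotentialOn u α β V := by
  obtain ⟨x₀, p, hp, rfl⟩ := exists_chartInv_eq x
  have hη : ∀ q ∈ chartDom x₀, ContDiffAt ℝ ∞ (formRep (g.flat (g.accel u)) x₀) q := fun q hq ↦
    g.formSmoothAt_accel hu _ x₀ q hq rfl
  have hp0 : formRep (g.flat (g.accel u)) x₀ p ≠ 0 := by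
    intro h0
    obtain ⟨A, hA⟩ := exists_chartFrame_eq hp (g.accel u (chartInv x₀ p))
    refine g.flat_accel_accel_ne_zero hu ha ?_
    rw [← hA]
    exact congr($h0 A)
  obtain ⟨V, α, β, hV, hpV, hVW, hα, hβ, hαβ⟩ := exists_integrating_factor
    (isOpen_chartDom_inter_preimage hW x₀) (fun q hq ↦ (hη q hq.1).contDiffWithinAt)
    (fun q hq X Y Z ↦ by
      have := hv _ hq.2 (chartFrame x₀ q X) (chartFrame x₀ q Y) (chartFrame x₀ q Z)
      have hd := (hη q hq.1).differentiableAt (by simp)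
      rw [wedge12, extD_chartFrame hq.1 hd, extD_chartFrame hq.1 hd,
        extD_chartFrame hq.1 hd] at this
      exact this) ⟨hp, hx⟩ hp0
  -- Transfers pointwise statements from coordinates to the corresponding open set of the manifold.
  have hpt : ∀ {P : M → Prop}, (∀ q ∈ V, P (chartInv x₀ q)) →
      ∀ y ∈ (extChartAt (𝓡 4) x₀).source ∩ extChartAt (𝓡 4) x₀ ⁻¹' V, P y := by
    intro P h y hy
    have := h _ hy.2
    rwa [show chartInv x₀ (extChartAt (𝓡 4) x₀ y) = y from
      (extChartAt (𝓡 4) x₀).left_inv hy.1] at this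
  have hsm : ∀ {k : R4 → ℝ}, ContDiffOn ℝ ∞ k V →
      ContMDiffOn (𝓡 4) 𝓘(ℝ, ℝ) ∞ (k ∘ extChartAt (𝓡 4) x₀)
        ((extChartAt (𝓡 4) x₀).source ∩ extChartAt (𝓡 4) x₀ ⁻¹' V) := by
    intro k hk
    refine hpt fun q hq ↦ ContMDiffAt.contMDiffWithinAt ?_
    exact contMDiffAt_of_comp_chartInv (hVW hq).1 ((hk.contDiffAt
      (hV.mem_nhds hq)).congr_of_eventuallyEq (comp_extChartAt_comp_chartInv k (hVW hq).1))
  refine ⟨_, isOpen_source_inter_preimage hV x₀, ⟨by simpa using mem_source_chartInv hp, ?_⟩,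
    hpt fun q hq ↦ (hVW hq).2, α ∘ extChartAt (𝓡 4) x₀, β ∘ extChartAt (𝓡 4) x₀,
    hsm hα, hsm hβ, hpt fun q hq ↦ ?_⟩
  · rw [Set.mem_preimage, chart_chartInv hp]
    exact hpV
  · have hq' := (hVW hq).1
    rw [Function.comp_apply, chart_chartInv hq']
    refine ⟨(hαβ q hq).1, ?_⟩
    ext X
    obtain ⟨X, rfl⟩ := exists_chartFrame_eq hq' X
    have h1 := comp_extChartAt_comp_chartInv α hq'
    rw [differential_chartFrame hq' (((hα.contDiffAt (hV.mem_nhds hq)).differentiableAt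
      (by simp)).congr_of_eventuallyEq h1), h1.fderiv_eq]
    exact congr($((hαβ q hq).2) X)

section Potential

variable {α β : M → ℝ}

theorem IsPotentialOn.differential_apply (h : g.IsPotentialOn u α β W) (hx : x ∈ W) (X : Tan x) :
    differential α x X = β x * g.flat (g.accel u) x X :=
  congr($((h.2.2 x hx).2) X).symm

/-- d(βa) = d(dα) = 0, expanded by the Leibniz rule. -/
theorem IsPotentialOn.extD_eq_zero (hu : g.IsUnitTimelike u) (hW : IsOpen W)
    (h : g.IsPotentialOn u α β W) (hx : x ∈ W) (X Y : Tan x) :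
    differential β x X * g.flat (g.accel u) x Y - differential β x Y * g.flat (g.accel u) x X +
      β x * extD (g.flat (g.accel u)) x X Y = 0 := by
  have hα : ∀ᶠ y in 𝓝 x, ContMDiffAt (𝓡 4) 𝓘(ℝ, ℝ) ∞ α y := by
    filter_upwards [hW.mem_nhds hx] with y hy using h.1.contMDiffAt (hW.mem_nhds hy)
  rw [← extD_smul (g.formSmoothAt_accel hu x) (h.2.1.contMDiffAt (hW.mem_nhds hx)),
    ← extD_differential hα X Y]
  refine extD_congr (formSmoothAt_differential hα) ?_ X Y
  filter_upwards [hW.mem_nhds hx] with y hy using (h.2.2 y hy).2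

/-- Evaluate dβ ∧ a + β da = 0 on (u, a) and divide by a². The integrating factor thus evolves along
u exactly as a difference of solutions does. -/
theorem IsPotentialOn.differential_factor (hu : g.IsUnitTimelike u) (ha : g.accel u x ≠ 0)
    (hW : IsOpen W) (h : g.IsPotentialOn u α β W) (hx : x ∈ W)
    (hd : ∀ Y, extD (g.flat (g.accel u)) x (u x) Y =
      -((γ - 1) * g.expansion u x * g.flat (g.accel u) x Y)) :
    differential β x (u x) = g.expansion u x * ((γ - 1) * β x) := by
  have h1 := h.extD_eq_zero hu hW hx (u x) (g.accel u x)
  rw [hd, g.flat_accel_self hu] at h1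
  refine mul_right_cancel₀ (g.flat_accel_accel_ne_zero hu ha) ?_
  linear_combination h1

/-- The differential of φ(α) is a multiple of a: it vanishes on u and drops out after wedging with
a. So βφ(α) inherits the homogeneous system from β. -/
theorem IsPotentialOn.isSolutionOn (hu : g.IsUnitTimelike u) (ha : ∀ x, g.accel u x ≠ 0)
    (hW : IsOpen W) (h : g.IsPotentialOn u α β W)
    (hd : ∀ x ∈ W, ∀ Y, extD (g.flat (g.accel u)) x (u x) Y =
      -((γ - 1) * g.expansion u x * g.flat (g.accel u) x Y))
    (hf₀ : g.IsSolutionOn u γ f₀ W) {φ : ℝ → ℝ} (hφ : ContDiffOn ℝ ∞ φ (α '' W)) :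
    g.IsSolutionOn u γ (fun x ↦ f₀ x + β x * φ (α x)) W := by
  have hk : ContMDiffOn (𝓡 4) 𝓘(ℝ, ℝ) ∞ (fun x ↦ φ (α x)) W :=
    hφ.contMDiffOn.comp h.1 fun y hy ↦ Set.mem_image_of_mem α hy
  have hdm : ∀ x ∈ W, ∀ X, differential (fun x ↦ β x * φ (α x)) x X =
      β x * differential (fun x ↦ φ (α x)) x X + φ (α x) * differential β x X :=
    fun x hx ↦ differential_mul (h.2.1.contMDiffAt (hW.mem_nhds hx))
      (hk.contMDiffAt (hW.mem_nhds hx))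
  refine isSolutionOn_add hu hW hf₀ (h.2.1.mul hk) (fun x hx ↦ ?_) (fun x hx X Y ↦ ?_)
  · obtain ⟨c, hc⟩ := exists_differential_comp hW h.1 hφ hx
    rw [hdm x hx, hc, h.differential_apply hx, g.flat_accel_self hu,
      h.differential_factor hu (ha x) hW hx (hd x hx)]
    ring
  · obtain ⟨c, hc⟩ := exists_differential_comp hW h.1 hφ hx
    rw [hdm x hx, hdm x hx, hc, hc, h.differential_apply hx, h.differential_apply hx]
    linear_combination φ (α x) * h.extD_eq_zero hu hW hx X Y

/-- For k = (f - f₀)/β, subtracting k(dβ ∧ a + β da) = 0 from the equation of the difference leaves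
dk ∧ dα = 0, and dα = βa ≠ 0. The neighbourhood depends on α alone, hence serves all solutions at
once. -/
theorem IsPotentialOn.exists_eq_comp (hu : g.IsUnitTimelike u) (ha : g.accel u x ≠ 0)
    (hW : IsOpen W) (h : g.IsPotentialOn u α β W) (hf₀ : g.IsSolutionOn u γ f₀ W) (hx : x ∈ W) :
    ∃ V : Set M, IsOpen V ∧ x ∈ V ∧ V ⊆ W ∧ ∀ f : M → ℝ, g.IsSolutionOn u γ f V →
      ∃ φ : ℝ → ℝ, ContDiffOn ℝ ∞ φ (α '' V) ∧ ∀ y ∈ V, f y = f₀ y + β y * φ (α y) := by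
  obtain ⟨x₀, p, hp, rfl⟩ := exists_chartInv_eq x
  have hα : ∀ q ∈ chartDom x₀ ∩ chartInv x₀ ⁻¹' W, ContDiffAt ℝ ∞ (α ∘ chartInv x₀) q :=
    fun q hq ↦ contDiffAt_comp_chartInv hq.1 (h.1.contMDiffAt (hW.mem_nhds hq.2))
  have hdα : fderiv ℝ (α ∘ chartInv x₀) p ≠ 0 := by
    intro h0
    obtain ⟨A, hA⟩ := exists_chartFrame_eq hp (g.accel u (chartInv x₀ p))
    refine mul_ne_zero (h.2.2 _ hx).1 (g.flat_accel_accel_ne_zero hu ha) ?_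
    rw [← h.differential_apply hx]
    refine (congrArg _ hA.symm).trans ?_
    rw [differential_chartFrame hp ((hα p ⟨hp, hx⟩).differentiableAt (by simp)), h0, zero_apply]
  obtain ⟨V, hV, hpV, hVW, hφ⟩ := exists_eq_comp_of_fderiv_eq_smul
    (isOpen_chartDom_inter_preimage hW x₀) (fun q hq ↦ (hα q hq).contDiffWithinAt) ⟨hp, hx⟩ hdα
  have hpt : ∀ {P : M → Prop}, (∀ q ∈ V, P (chartInv x₀ q)) →
      ∀ y ∈ (extChartAt (𝓡 4) x₀).source ∩ extChartAt (𝓡 4) x₀ ⁻¹' V, P y := by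
    intro P h y hy
    have := h _ hy.2
    rwa [show chartInv x₀ (extChartAt (𝓡 4) x₀ y) = y from
      (extChartAt (𝓡 4) x₀).left_inv hy.1] at this
  have hmem : ∀ q ∈ V, chartInv x₀ q ∈
      (extChartAt (𝓡 4) x₀).source ∩ extChartAt (𝓡 4) x₀ ⁻¹' V := fun q hq ↦
    ⟨by simpa using mem_source_chartInv (hVW hq).1, by
      rw [Set.mem_preimage, chart_chartInv (hVW hq).1]
      exact hq⟩
  have hVo := isOpen_source_inter_preimage hV x₀
  have hVW' : (extChartAt (𝓡 4) x₀).source ∩ extChartAt (𝓡 4) x₀ ⁻¹' V ⊆ W :=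
    hpt fun q hq ↦ (hVW hq).2
  refine ⟨_, hVo, hmem p hpV, hVW', fun f hf ↦ ?_⟩
  set V' := (extChartAt (𝓡 4) x₀).source ∩ extChartAt (𝓡 4) x₀ ⁻¹' V
  let k : M → ℝ := fun y ↦ (f y - f₀ y) * (β y)⁻¹
  have hk : ContMDiffOn (𝓡 4) 𝓘(ℝ, ℝ) ∞ k V' :=
    (hf.1.sub (hf₀.1.mono hVW')).mul ((h.2.1.mono hVW').inv₀ fun y hy ↦ (h.2.2 y (hVW' hy)).1)
  have hβk : ∀ y ∈ V', β y * k y = f y - f₀ y := by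
    intro y hy
    have := (h.2.2 y (hVW' hy)).1
    simp only [k]
    field_simp
  have hcross : ∀ y ∈ V', ∀ X Y, differential k y X * differential α y Y =
      differential k y Y * differential α y X := by
    intro y hy X Y
    have h1 : ∀ X, differential (fun y ↦ f y - f₀ y) y X =
        β y * differential k y X + k y * differential β y X := by
      intro X
      rw [← differential_mul (h.2.1.contMDiffAt (hW.mem_nhds (hVW' hy)))
        (hk.contMDiffAt (hVo.mem_nhds hy))]
      refine congr($(differential_congr ?_) X)
      filter_upwards [hVo.mem_nhds hy] with z hz using (hβk z hz).symm
    have h2 := (hf.sub hu hVo hy (hf₀.mono hVW')).2 X Y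
    rw [h1, h1, ← hβk y hy] at h2
    rw [h.differential_apply (hVW' hy), h.differential_apply (hVW' hy)]
    linear_combination h2 - k y * h.extD_eq_zero hu hW (hVW' hy) X Y
  have hk' : ∀ q ∈ V, ContDiffAt ℝ ∞ (k ∘ chartInv x₀) q := fun q hq ↦
    contDiffAt_comp_chartInv (hVW hq).1 (hk.contMDiffAt (hVo.mem_nhds (hmem q hq)))
  obtain ⟨φ, hφs, hφk⟩ := hφ (k ∘ chartInv x₀) (fun q hq ↦ (hk' q hq).contDiffWithinAt)
    fun q hq X Y ↦ by
      have hkd := (hk' q hq).differentiableAt (by simp)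
      have hαd := (hα q (hVW hq)).differentiableAt (by simp)
      have hqd := (hVW hq).1
      rw [← differential_chartFrame hqd hkd, ← differential_chartFrame hqd hαd,
        ← differential_chartFrame hqd hkd, ← differential_chartFrame hqd hαd]
      exact hcross _ (hmem q hq) _ _
  refine ⟨φ, hφs.mono ?_, hpt fun q hq ↦ ?_⟩
  · rintro _ ⟨y, hy, rfl⟩
    revert y
    exact hpt fun q hq ↦ ⟨q, hq, rfl⟩
  · have := hβk _ (hmem q hq)
    rw [← show k (chartInv x₀ q) = φ (α (chartInv x₀ q)) from hφk q hq, this]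
    ring

end Potential

/-! ### Necessity of the constraints on the closure -/

/-- Two solutions can differ only where the acceleration is integrable and `ν = 0`. -/
theorem IsSolutionOn.constraints_of_mem_closure (hu : g.IsUnitTimelike u)
    (o : ManifoldOrientation M) (ha : g.accel u x ≠ 0) (hθ : g.expansion u x ≠ 0) (hU : IsOpen U)
    (hf : g.IsSolutionOn u γ f U) (hf₀ : g.IsSolutionOn u γ f₀ U)
    (hx : x ∈ closure {y ∈ U | f y ≠ f₀ y}) : g.accelVorticity u o x = 0 ∧ g.nu u x = 0 := by
  have key : ∀ y ∈ {y ∈ U | f y ≠ f₀ y}, _ := fun y hy ↦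
    hf.constraints_of_ne hu hU hy.1 hf₀ hy.2
  obtain ⟨x₀, p, hp, rfl⟩ := exists_chartInv_eq x
  have hη := g.formSmoothAt_accel hu _ x₀ p hp rfl
  have hη' : ContDiffAt ℝ ∞ (fderiv ℝ (formRep (g.flat (g.accel u)) x₀)) p :=
    hη.fderiv_right (by simp)
  constructor
  · rw [g.accelVorticity_eq_zero_iff hu]
    intro X Y Z
    obtain ⟨X, rfl⟩ := exists_chartFrame_eq hp X
    obtain ⟨Y, rfl⟩ := exists_chartFrame_eq hp Y
    obtain ⟨Z, rfl⟩ := exists_chartFrame_eq hp Z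
    have hw : ∀ q ∈ chartDom x₀, wedge12 (g.flat (g.accel u) (chartInv x₀ q))
        (extD (g.flat (g.accel u)) (chartInv x₀ q)) (chartFrame x₀ q X) (chartFrame x₀ q Y)
        (chartFrame x₀ q Z) = formRep (g.flat (g.accel u)) x₀ q X *
          extDNormed (formRep (g.flat (g.accel u)) x₀) q Y Z +
        formRep (g.flat (g.accel u)) x₀ q Y *
          extDNormed (formRep (g.flat (g.accel u)) x₀) q Z X +
        formRep (g.flat (g.accel u)) x₀ q Z *
          extDNormed (formRep (g.flat (g.accel u)) x₀) q X Y := by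
      intro q hq
      have hd := (g.formSmoothAt_accel hu _).differentiableAt hq
      rw [wedge12, extD_chartFrame hq hd, extD_chartFrame hq hd, extD_chartFrame hq hd]
      rfl
    have h1 : ∀ X, ContDiffAt ℝ ∞ (fun q ↦ formRep (g.flat (g.accel u)) x₀ q X) p := fun X ↦
      hη.clm_apply contDiffAt_const
    have h2 : ∀ X Y, ContDiffAt ℝ ∞
        (fun q ↦ extDNormed (formRep (g.flat (g.accel u)) x₀) q X Y) p := fun X Y ↦
      ((hη'.clm_apply contDiffAt_const).clm_apply contDiffAt_const).sub
        ((hη'.clm_apply contDiffAt_const).clm_apply contDiffAt_const)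
    rw [hw p hp]
    refine eq_zero_of_chartInv_mem_closure hp ((((h1 X).mul (h2 Y Z)).add
      ((h1 Y).mul (h2 Z X))).add ((h1 Z).mul (h2 X Y))).continuousAt hx fun q hq hqS ↦ ?_
    exact (hw q hq).symm.trans ((key _ hqS).1 _ _ _)
  · have hθs := contDiffAt_comp_chartInv hp (g.contMDiff_expansion hu).contMDiffAt
    have hθs' : ContDiffAt ℝ ∞ (fderiv ℝ (g.expansion u ∘ chartInv x₀)) p :=
      hθs.fderiv_right (by simp)
    have hυ := g.formSmoothAt_flat hu _ x₀ p hp rfl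
    have hû := g.contDiffAt_vecRep hu hp
    -- The gradient constraint holds on all vectors, so it can be tested on the constant coordinate
    -- vector that equals a at the limit point only.
    obtain ⟨A, hA⟩ := exists_chartFrame_eq hp (g.accel u (chartInv x₀ p))
    have hw : ∀ q ∈ chartDom x₀,
        differential (g.expansion u) (chartInv x₀ q) (chartFrame x₀ q A) +
          differential (g.expansion u) (chartInv x₀ q) (u (chartInv x₀ q)) *
            g.flat u (chartInv x₀ q) (chartFrame x₀ q A) +
          2 * g.expansion u (chartInv x₀ q) *
            g.flat (g.accel u) (chartInv x₀ q) (chartFrame x₀ q A) =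
        fderiv ℝ (g.expansion u ∘ chartInv x₀) q A +
          fderiv ℝ (g.expansion u ∘ chartInv x₀) q (vecRep u x₀ q) *
            formRep (g.flat u) x₀ q A +
          2 * (g.expansion u ∘ chartInv x₀) q * formRep (g.flat (g.accel u)) x₀ q A := by
      intro q hq
      have hd := (contDiffAt_comp_chartInv hq
        (g.contMDiff_expansion hu).contMDiffAt).differentiableAt (by simp)
      rw [← chartFrame_vecRep u hq, differential_chartFrame hq hd, differential_chartFrame hq hd]
      rfl
    have h1 := eq_zero_of_chartInv_mem_closure hp
      (((hθs'.clm_apply (contDiffAt_const (c := A))).add ((hθs'.clm_apply hû).mul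
        (hυ.clm_apply (contDiffAt_const (c := A))))).add ((contDiffAt_const (c := (2 : ℝ)).mul
        hθs).mul (hη.clm_apply (contDiffAt_const (c := A))))).continuousAt hx fun q hq hqS ↦
      (hw q hq).symm.trans ((key _ hqS).2 _)
    replace h1 := (hw p hp).trans h1
    rw [hA, g.flat_apply_accel hu] at h1
    rw [g.nu_eq_zero_iff hu ha hθ]
    linear_combination h1

end LorentzMetric

end Spacetime

end

/-! ### The main theorem -/

open Spacetime in
theorem mainTheorem4 {M : Type*} [TopologicalSpace M] [T2Space M] [ChartedSpace R4 M]
    [IsManifold (𝓡 4) ∞ M] (g : LorentzMetric M) (o : ManifoldOrientation M)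
    (u : ∀ x : M, Tan x) (hu : g.IsUnitTimelike u)
    (ha : ∀ x, g.accel u x ≠ 0) (hθ : ∀ x, g.expansion u x ≠ 0)
    (γ : ℝ) (hγ : 1 < γ) (f₀ : M → ℝ) (hf₀ : g.IsSolutionOn u γ f₀ Set.univ) :
    -- necessity, in its strongest form
    (∀ (U : Set M) (f : M → ℝ), IsOpen U → g.IsSolutionOn u γ f U →
      ∀ x ∈ U, x ∈ closure {y ∈ U | f y ≠ f₀ y} →
        g.accelVorticity u o x = 0 ∧ g.nu u x = 0) ∧
    -- the equivalence, near every point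
    (∀ x₀ : M,
      (∃ U : Set M, IsOpen U ∧ x₀ ∈ U ∧ ∃ f : M → ℝ, g.IsSolutionOn u γ f U ∧
        ∀ y ∈ U, f y ≠ f₀ y) ↔
      ∀ᶠ y in 𝓝 x₀, g.accelVorticity u o y = 0 ∧ g.nu u y = 0) ∧
    -- the general solution
    (∀ W : Set M, IsOpen W →
      (∀ y ∈ W, g.accelVorticity u o y = 0 ∧ g.nu u y = 0) →
      (∀ x ∈ W, ∃ V : Set M, IsOpen V ∧ x ∈ V ∧ V ⊆ W ∧
        ∃ α β : M → ℝ, g.IsPotentialOn u α β V) ∧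
      ∀ α β : M → ℝ, g.IsPotentialOn u α β W →
        (∀ φ : ℝ → ℝ, ContDiffOn ℝ ∞ φ (α '' W) →
          g.IsSolutionOn u γ (fun x ↦ f₀ x + β x * φ (α x)) W) ∧
        ∀ x ∈ W, ∃ V : Set M, IsOpen V ∧ x ∈ V ∧ V ⊆ W ∧
          ∀ f : M → ℝ, g.IsSolutionOn u γ f V →
            ∃ φ : ℝ → ℝ, ContDiffOn ℝ ∞ φ (α '' V) ∧
              ∀ y ∈ V, f y = f₀ y + β y * φ (α y)) := by
  have hne : ∀ {U : Set M} {f : M → ℝ}, IsOpen U → g.IsSolutionOn u γ f U →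
      ∀ x ∈ U, x ∈ closure {y ∈ U | f y ≠ f₀ y} →
        g.accelVorticity u o x = 0 ∧ g.nu u x = 0 := fun hU hf x _ hx ↦
    hf.constraints_of_mem_closure hu o (ha x) (hθ x) hU (hf₀.mono (Set.subset_univ _)) hx
  have hv : ∀ {W : Set M}, (∀ y ∈ W, g.accelVorticity u o y = 0 ∧ g.nu u y = 0) → ∀ x ∈ W,
      ∀ X Y Z, wedge12 (g.flat (g.accel u) x) (extD (g.flat (g.accel u)) x) X Y Z = 0 :=
    fun hW x hx ↦ (g.accelVorticity_eq_zero_iff hu o x).1 (hW x hx).1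
  have hd : ∀ {W : Set M}, IsOpen W →
      (∀ y ∈ W, g.accelVorticity u o y = 0 ∧ g.nu u y = 0) → ∀ x ∈ W,
      ∀ Y, extD (g.flat (g.accel u)) x (u x) Y =
        -((γ - 1) * g.expansion u x * g.flat (g.accel u) x Y) := fun hW h x hx Y ↦
    (hf₀.mono (Set.subset_univ _)).extD_accel_apply hu ha hθ hW (hv h) (fun y hy ↦ (h y hy).2) hx Y
  refine ⟨fun U f ↦ hne, fun x₀ ↦ ⟨?_, fun h ↦ ?_⟩, fun W hW h ↦ ⟨fun x hx ↦ ?_, ?_⟩⟩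
  · rintro ⟨U, hU, hx₀, f, hf, hff₀⟩
    filter_upwards [hU.mem_nhds hx₀] with y hy
    exact hne hU hf y hy (subset_closure ⟨hy, hff₀ y hy⟩)
  · obtain ⟨W, h, hW, hx₀⟩ := eventually_nhds_iff.1 h
    obtain ⟨V, hV, hxV, hVW, α, β, hαβ⟩ :=
      LorentzMetric.exists_isPotentialOn hu (ha x₀) hW (hv h) hx₀
    -- Taking φ = 1 gives the second solution f₀ + β, which differs from f₀ everywhere since β has
    -- no zeros.
    refine ⟨V, hV, hxV, _, hαβ.isSolutionOn hu ha hV (fun x hx ↦ hd hW h x (hVW hx))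
      (hf₀.mono (Set.subset_univ _)) (φ := fun _ ↦ 1) contDiffOn_const, fun y hy ↦ ?_⟩
    simpa using (hαβ.2.2 y hy).1
  · exact LorentzMetric.exists_isPotentialOn hu (ha x) hW (hv h) hx
  · intro α β hαβ
    have hf₀' : g.IsSolutionOn u γ f₀ W := hf₀.mono (Set.subset_univ _)
    exact ⟨fun φ hφ ↦ hαβ.isSolutionOn hu ha hW (hd hW h) hf₀' hφ,
      fun x hx ↦ hαβ.exists_eq_comp hu (ha x) hW hf₀' hx⟩
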